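/- Let $\mathcal{E}$ be a locally cartesian closed category: $\mathcal{E}$ has a terminal object and binary products, and every morphism $f : X \to Y$ comes with a chosen pullback functor $\Delta_f : \mathcal{E}/Y \to \mathcal{E}/X$, right adjoint to postcomposition $\Sigma_f$, and a chosen right adjoint $\Pi_f$ of $\Delta_f$. Fix objects $I, J$ of $\mathcal{E}$. **The 2-category $\mathfrak{Poly}^{\mathrm{cart}}_{\mathcal{E}}(I,J)$.** Its objects are the polynomials from $I$ to $J$, i.e. the diagrams $F = (I \xleftarrow{s} B \xrightarrow{f} A \xrightarrow{t} J)$. For $F$ as above and $G = (I \xleftarrow{u} D \xrightarrow{g} C \xrightarrow{v} J)$, a morphism $\varphi : F \to G$ consists of $\varphi_0 : A \to C$ with $v\varphi_0 = t$ and, writing $D_\varphi = \Delta_{\varphi_0} D$ for the chosen pullback of $g$ along $\varphi_0$ and $\varphi_1 : D_\varphi \to D$ for its projection, a morphism $\varphi_2 : D_\varphi \to B$ such that $f\varphi_2$ is the projection $D_\varphi \to A$ and $s\varphi_2 = u\varphi_1$. It is cartesian if $\varphi_2$ is invertible. Composition of $\varphi : F \to G$ with $\psi : G \to H$ has $(\psi\varphi)_0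 = \psi_0\varphi_0$ and $(\psi\varphi)_2 = \varphi_2 \circ \varphi_0^*(\psi_2)$, where $\varphi_0^*(\psi_2)$ is the morphism from the chosen pullback of the third polynomial along $\psi_0\varphi_0$ to $D_\varphi$ induced by $\psi_2$. The 1-cells are the cartesian morphisms. The 2-cells $\varphi \Rightarrow \psi$ between $\varphi, \psi : F \to G$ are the adjustments, i.e. the morphisms $\alpha : D_\varphi \to D_\psi$ with $\psi_2\alpha = \varphi_2$, composed vertically as in $\mathcal{E}$; their horizontal composites are the unique adjustments of the required type. **The 2-category $\mathbf{Cat}(\mathcal{E}/(I\times J))$** has internal categories in the slice $\mathcal{E}/(I\times J)$ as objects, internal functors as 1-cells, and internal natural transformations as 2-cells. **The internal category $\mathbb{A}_F$ and the internal functor $\mathbb{A}_\varphi$.** For a morphism $f : B \to A$ of a locally cartesian closed category, the internal full subcategory associated with $f$ has object of objects $A$; its object of arrows, with its domain and codomain, is the exponential $f_2^{f_1}$ in the slice over $A \times A$, where $f_i$ is the pullback of $f$ along the $i$-th projection $A \times A \to A$, so that an arrow $a \to a'$ is a map of fibres $B_a \to B_{a'}$; identities and composition are those of maps. A pullback square from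 $f : B \to A$ to $g : D \to C$ with base $A \to C$ and top $B \to D$ induces an internal functor between the associated internal full subcategories: it is $A \to C$ on objects, and on arrows it sends a map $B_a \to B_{a'}$ to the corresponding map of fibres of $g$ under the isomorphisms of fibres given by the square. For a polynomial $F$, let $\mathbb{A}_F$ be the internal full subcategory of $\mathcal{E}/(I \times J)$ associated with $\langle s, f\rangle : B \to I \times A$, where $B$ and $I \times A$ lie over $I \times J$ through $\langle s, tf \rangle$ and $\mathrm{id}_I \times t$. For a cartesian morphism $\varphi : F \to G$, let $\mathbb{A}_\varphi : \mathbb{A}_F \to \mathbb{A}_G$ be the internal functor induced by the pullback square over $I \times J$ with left side $\langle s, f\rangle$, right side $\langle u, g \rangle$, base $\mathrm{id}_I \times \varphi_0$ and top $\varphi_1\varphi_2^{-1} : B \to D$. **Theorem.** There is a (strict) 2-functor $$\mathbb{A}_{(-)} : \mathfrak{Poly}^{\mathrm{cart}}_{\mathcal{E}}(I,J) \to \mathbf{Cat}(\mathcal{E}/(I\times J))$$ whose action on objects and 1-cells is $F \mapsto \mathbb{A}_F$, $\varphi \mapsto \mathbb{A}_\varphi$, and which is locally full and faithful: for all polynomials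 $F, G$ from $I$ to $J$, the functor $\mathfrak{Poly}^{\mathrm{cart}}_{\mathcal{E}}(I,J)(F,G) \to \mathbf{Cat}(\mathcal{E}/(I\times J))(\mathbb{A}_F, \mathbb{A}_G)$ is full and faithful. -/

import Mathlib

open CategoryTheory MonoidalCategory CartesianMonoidalCategory

universe v u

attribute [-instance] CategoryTheory.catToReflQuiver

noncomputable section

/-- A locally cartesian closed category, as a category with structure: a terminal object and binary
products, a chosen pullback functor `Δ_f` along every morphism `f`, right adjoint to
postcomposition `Σ_f`, and a chosen right adjoint `Π_f` of every `Δ_f`. -/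
class LCCC (E : Type u) [Category.{v} E] extends CartesianMonoidalCategory E where
  pullbacks : ChosenPullbacks E
  pushforwards {X Y : E} (f : X ⟶ Y) : ExponentiableMorphism f

namespace LCCC

variable {E : Type u} [Category.{v} E]

instance instPullback [LCCC E] {X Y : E} (f : X ⟶ Y) : ChosenPullbacksAlong f :=
  LCCC.pullbacks f

instance instPushforward [LCCC E] {X Y : E} (f : X ⟶ Y) : ExponentiableMorphism f :=
  LCCC.pushforwards f

variable [LCCC E] {S : E}

/-- The chosen pullbacks in a slice, computed in `E` through `(E/S)/X ≌ E/X`. -/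
@[reducible]
def overPullbacks (S : E) : ChosenPullbacks (Over S) := fun {X Y} f =>
  { pullback := X.iteratedSliceForward ⋙ ChosenPullbacksAlong.pullback f.left ⋙
      Y.iteratedSliceBackward
    mapPullbackAdj :=
      (((Y.iteratedSliceEquiv.toAdjunction.comp
        (ChosenPullbacksAlong.mapPullbackAdj f.left)).comp
          X.iteratedSliceEquiv.symm.toAdjunction)).ofNatIsoLeft
            (Over.iteratedSliceEquivOverMapIso f) }

@[reducible]
def overPushforward {X Y : Over S} (f : Y ⟶ X) :
    @ExponentiableMorphism _ _ _ _ f (overPullbacks S f) :=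
  @ExponentiableMorphism.mk _ _ _ _ f (overPullbacks S f)
    (Y.iteratedSliceForward ⋙ ExponentiableMorphism.pushforward f.left ⋙ X.iteratedSliceBackward)
    ((X.iteratedSliceEquiv.toAdjunction.comp
      (ExponentiableMorphism.pullbackPushforwardAdj f.left)).comp
        Y.iteratedSliceEquiv.symm.toAdjunction)

/-- Every slice of a locally cartesian closed category is locally cartesian closed. -/
instance instOver (S : E) : LCCC (Over S) where
  __ := ChosenPullbacksAlong.cartesianMonoidalCategoryOver S
  pullbacks := overPullbacks S
  pushforwards f := overPushforward f

end LCCC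

/-! ## Internal categories -/

open ChosenPullbacksAlong in
/-- An internal category. Composition is written in diagrammatic order: `comp` is defined on the
pullback of `cod` and `dom`, the object of pairs `(k, l)` with `cod k = dom l`. Associativity is
stated on generalised elements, which is the same as stating it on the object of composable
triples. -/
structure InternalCat (C : Type u) [Category.{v} C] [ChosenPullbacks C] where
  Ob : C
  Arr : C
  dom : Arr ⟶ Ob
  cod : Arr ⟶ Ob
  ident : Ob ⟶ Arr
  comp : pullbackObj cod dom ⟶ Arr
  ident_dom : ident ≫ dom = 𝟙 Ob
  ident_cod : ident ≫ cod = 𝟙 Ob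
  comp_dom : comp ≫ dom = fst cod dom ≫ dom
  comp_cod : comp ≫ cod = snd cod dom ≫ cod
  id_comp : lift (dom ≫ ident) (𝟙 Arr) (by simp [ident_cod]) ≫ comp = 𝟙 Arr
  comp_id : lift (𝟙 Arr) (cod ≫ ident) (by simp [ident_dom]) ≫ comp = 𝟙 Arr
  assoc {X : C} (k l m : X ⟶ Arr) (h₁ : k ≫ cod = l ≫ dom) (h₂ : l ≫ cod = m ≫ dom) :
    lift (lift k l h₁ ≫ comp) m (by simp [comp_cod, h₂]) ≫ comp =
      lift k (lift l m h₂ ≫ comp) (by simp [comp_dom, h₁]) ≫ comp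

namespace InternalCat

variable {C : Type u} [Category.{v} C] [ChosenPullbacks C]

/-- The composite of two composable generalised arrows, in diagrammatic order. -/
def cmp (A : InternalCat C) {X : C} (k l : X ⟶ A.Arr) (h : k ≫ A.cod = l ≫ A.dom) : X ⟶ A.Arr :=
  ChosenPullbacksAlong.lift k l h ≫ A.comp

section
variable (A : InternalCat C) {X Y : C}

@[simp]
theorem cmp_dom (k l : X ⟶ A.Arr) (h : k ≫ A.cod = l ≫ A.dom) :
    A.cmp k l h ≫ A.dom = k ≫ A.dom := by
  simp [cmp, A.comp_dom]

@[simp]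
theorem cmp_cod (k l : X ⟶ A.Arr) (h : k ≫ A.cod = l ≫ A.dom) :
    A.cmp k l h ≫ A.cod = l ≫ A.cod := by
  simp [cmp, A.comp_cod]

theorem pre_cmp (x : Y ⟶ X) (k l : X ⟶ A.Arr) (h : k ≫ A.cod = l ≫ A.dom) :
    x ≫ A.cmp k l h = A.cmp (x ≫ k) (x ≫ l) (by simp [h]) := by
  rw [cmp, cmp, ← Category.assoc]
  congr 1
  ext <;> simp

theorem cmp_congr {k l k' l' : X ⟶ A.Arr} (hk : k = k') (hl : l = l')
    (h : k ≫ A.cod = l ≫ A.dom) : A.cmp k l h = A.cmp k' l' (by rw [← hk, ← hl, h]) := by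
  subst hk hl; rfl

theorem cmp_assoc (k l m : X ⟶ A.Arr) (h₁ : k ≫ A.cod = l ≫ A.dom) (h₂ : l ≫ A.cod = m ≫ A.dom) :
    A.cmp (A.cmp k l h₁) m (by simp [h₂]) = A.cmp k (A.cmp l m h₂) (by simp [h₁]) :=
  A.assoc k l m h₁ h₂

theorem id_cmp (a : X ⟶ A.Ob) (k : X ⟶ A.Arr) (h : (a ≫ A.ident) ≫ A.cod = k ≫ A.dom) :
    A.cmp (a ≫ A.ident) k h = k := by
  have ha : a = k ≫ A.dom := by simpa [A.ident_cod] using h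
  subst ha
  have := congrArg (k ≫ ·) A.id_comp
  change k ≫ A.cmp _ _ _ = _ at this
  rw [pre_cmp] at this
  simpa using this

theorem cmp_id (a : X ⟶ A.Ob) (k : X ⟶ A.Arr) (h : k ≫ A.cod = (a ≫ A.ident) ≫ A.dom) :
    A.cmp k (a ≫ A.ident) h = k := by
  have ha : a = k ≫ A.cod := by simpa [A.ident_dom] using h.symm
  subst ha
  have := congrArg (k ≫ ·) A.comp_id
  change k ≫ A.cmp _ _ _ = _ at this
  rw [pre_cmp] at this
  simpa using this
end

/-- An internal functor. -/
@[ext]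
structure Fun (A B : InternalCat C) where
  ob : A.Ob ⟶ B.Ob
  arr : A.Arr ⟶ B.Arr
  arr_dom : arr ≫ B.dom = A.dom ≫ ob
  arr_cod : arr ≫ B.cod = A.cod ≫ ob
  ident_arr : A.ident ≫ arr = ob ≫ B.ident
  comp_arr : A.comp ≫ arr =
    B.cmp (ChosenPullbacksAlong.fst A.cod A.dom ≫ arr) (ChosenPullbacksAlong.snd A.cod A.dom ≫ arr)
      (by simp only [Category.assoc, arr_dom, arr_cod]
          rw [← Category.assoc, ChosenPullbacksAlong.condition, Category.assoc])

theorem Fun.cmp_arr {A B : InternalCat C} (F : Fun A B) {X : C} (k l : X ⟶ A.Arr)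
    (h : k ≫ A.cod = l ≫ A.dom) :
    A.cmp k l h ≫ F.arr = B.cmp (k ≫ F.arr) (l ≫ F.arr)
      (by simp only [Category.assoc, F.arr_dom, F.arr_cod, reassoc_of% h]) := by
  rw [cmp, Category.assoc, F.comp_arr, pre_cmp]
  exact cmp_congr _ (by simp) (by simp) _

/-- An internal natural transformation: a morphism assigning to each object `a` of `A` an arrow
`F a ⟶ G a` of `B`, natural in the arrows of `A`. -/
@[ext]
structure NatTrans {A B : InternalCat C} (F G : Fun A B) where
  app : A.Ob ⟶ B.Arr
  app_dom : app ≫ B.dom = F.ob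
  app_cod : app ≫ B.cod = G.ob
  naturality :
    B.cmp F.arr (A.cod ≫ app) (by simp [app_dom, F.arr_cod]) =
      B.cmp (A.dom ≫ app) G.arr (by simp [app_cod, G.arr_dom])

theorem NatTrans.nat {A B : InternalCat C} {F G : Fun A B} (α : NatTrans F G) {X : C}
    (k : X ⟶ A.Arr) (a b : X ⟶ A.Ob) (ha : k ≫ A.dom = a) (hb : k ≫ A.cod = b) :
    B.cmp (k ≫ F.arr) (b ≫ α.app) (by simp [α.app_dom, F.arr_cod, ← hb]) =
      B.cmp (a ≫ α.app) (k ≫ G.arr) (by simp [α.app_cod, G.arr_dom, ← ha]) := by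
  subst ha hb
  have := congrArg (k ≫ ·) α.naturality
  simpa only [pre_cmp, ← Category.assoc] using this

instance : CategoryStruct (InternalCat C) where
  Hom A B := Fun A B
  id A :=
    { ob := 𝟙 _
      arr := 𝟙 _
      arr_dom := by simp
      arr_cod := by simp
      ident_arr := by simp
      comp_arr := by
        rw [Category.comp_id, cmp]
        conv_lhs => rw [← Category.id_comp A.comp]
        congr 1
        ext <;> simp }
  comp {A B D} F G :=
    { ob := F.ob ≫ G.ob
      arr := F.arr ≫ G.arr
      arr_dom := by rw [Category.assoc, G.arr_dom, ← Category.assoc, F.arr_dom, Category.assoc]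
      arr_cod := by rw [Category.assoc, G.arr_cod, ← Category.assoc, F.arr_cod, Category.assoc]
      ident_arr := by
        rw [← Category.assoc, F.ident_arr, Category.assoc, G.ident_arr, Category.assoc]
      comp_arr := by
        rw [← Category.assoc, F.comp_arr, G.cmp_arr]
        exact cmp_congr _ (by simp) (by simp) _ }

@[simp] theorem id_ob (A : InternalCat C) : Fun.ob (𝟙 A) = 𝟙 A.Ob := rfl
@[simp] theorem id_arr (A : InternalCat C) : Fun.arr (𝟙 A) = 𝟙 A.Arr := rfl
@[simp] theorem comp_ob {A B D : InternalCat C} (F : A ⟶ B) (G : B ⟶ D) :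
    Fun.ob (F ≫ G) = Fun.ob F ≫ Fun.ob G := rfl
@[simp] theorem comp_arr' {A B D : InternalCat C} (F : A ⟶ B) (G : B ⟶ D) :
    Fun.arr (F ≫ G) = Fun.arr F ≫ Fun.arr G := rfl

/-- Internal functors and internal natural transformations, with vertical composition. -/
instance homCat (A B : InternalCat C) : Category (A ⟶ B) where
  Hom F G := NatTrans F G
  id F :=
    { app := Fun.ob F ≫ B.ident
      app_dom := by simp [B.ident_dom]
      app_cod := by simp [B.ident_cod]
      naturality := by
        rw [cmp_congr _ rfl (Category.assoc _ _ _).symm, cmp_congr _ (Category.assoc _ _ _).symm rfl,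
          cmp_id, id_cmp] }
  comp {F G H} α β :=
    { app := B.cmp α.app β.app (by rw [α.app_cod, β.app_dom])
      app_dom := by simp [α.app_dom]
      app_cod := by simp [β.app_cod]
      naturality := by
        have h₁ := α.naturality
        have h₂ := β.naturality
        rw [cmp_congr _ rfl (pre_cmp _ _ _ _ _), cmp_congr _ (pre_cmp _ _ _ _ _) rfl,
          ← cmp_assoc, cmp_congr _ h₁ rfl, cmp_assoc, cmp_congr _ rfl h₂, cmp_assoc]
        all_goals simp [α.app_dom, β.app_dom, Fun.arr_cod] }
  id_comp {F G} α := by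
    apply NatTrans.ext
    exact id_cmp _ _ _ (by simp [B.ident_cod, α.app_dom])
  comp_id {F G} α := by
    apply NatTrans.ext
    exact cmp_id _ _ _ (by simp [B.ident_dom, α.app_cod])
  assoc {F G H K} α β γ := by
    apply NatTrans.ext
    exact cmp_assoc _ _ _ _ (by simp [α.app_cod, β.app_dom]) (by simp [γ.app_dom, β.app_cod])

@[ext]
theorem hom₂_ext {A B : InternalCat C} {F G : A ⟶ B} {α β : F ⟶ G}
    (h : NatTrans.app α = NatTrans.app β) : α = β := NatTrans.ext h

@[simp] theorem id_app {A B : InternalCat C} (F : A ⟶ B) :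
    NatTrans.app (𝟙 F) = Fun.ob F ≫ B.ident := rfl

theorem comp_app {A B : InternalCat C} {F G H : A ⟶ B} (α : F ⟶ G) (β : G ⟶ H) :
    NatTrans.app (α ≫ β) =
      B.cmp α.app β.app (by rw [α.app_cod, β.app_dom]) := rfl

theorem eqToHom_app {A B : InternalCat C} {F G : A ⟶ B} (h : F = G) :
    NatTrans.app (eqToHom h) = Fun.ob F ≫ B.ident := by
  subst h; rfl

theorem eqToHom_comp_app {A B : InternalCat C} {F G H : A ⟶ B} (h : F = G) (β : G ⟶ H) :
    NatTrans.app (eqToHom h ≫ β) = NatTrans.app β := by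
  subst h; simp

theorem comp_eqToHom_app {A B : InternalCat C} {F G H : A ⟶ B} (h : G = H) (α : F ⟶ G) :
    NatTrans.app (α ≫ eqToHom h) = NatTrans.app α := by
  subst h; simp

/-- Whiskering of an internal natural transformation with an internal functor on the left. -/
def whiskerL {A B D : InternalCat C} (F : A ⟶ B) {G H : B ⟶ D} (α : G ⟶ H) : F ≫ G ⟶ F ≫ H :=
  NatTrans.mk (F := F ≫ G) (G := F ≫ H) (Fun.ob F ≫ α.app)
    (by simp [α.app_dom]) (by simp [α.app_cod]) (by
      have := α.nat (Fun.arr F) _ _ F.arr_dom F.arr_cod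
      simpa only [comp_arr', Category.assoc] using this)

/-- Whiskering of an internal natural transformation with an internal functor on the right. -/
def whiskerR {A B D : InternalCat C} {F G : A ⟶ B} (α : F ⟶ G) (H : B ⟶ D) : F ≫ H ⟶ G ≫ H :=
  NatTrans.mk (F := F ≫ H) (G := G ≫ H) (α.app ≫ Fun.arr H)
    (by rw [Category.assoc, H.arr_dom, ← Category.assoc, α.app_dom]; rfl)
    (by rw [Category.assoc, H.arr_cod, ← Category.assoc, α.app_cod]; rfl) (by
      have := congrArg (· ≫ Fun.arr H) α.naturality
      simpa only [Fun.cmp_arr, comp_arr', Category.assoc] using this)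

@[simp] theorem whiskerL_app {A B D : InternalCat C} (F : A ⟶ B) {G H : B ⟶ D} (α : G ⟶ H) :
    NatTrans.app (whiskerL F α) = Fun.ob F ≫ α.app := rfl
@[simp] theorem whiskerR_app {A B D : InternalCat C} {F G : A ⟶ B} (α : F ⟶ G) (H : B ⟶ D) :
    NatTrans.app (whiskerR α H) = α.app ≫ Fun.arr H := rfl

theorem fun_id_comp {A B : InternalCat C} (F : A ⟶ B) : 𝟙 A ≫ F = F :=
  Fun.ext (Category.id_comp _) (Category.id_comp _)
theorem fun_comp_id {A B : InternalCat C} (F : A ⟶ B) : F ≫ 𝟙 B = F :=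
  Fun.ext (Category.comp_id _) (Category.comp_id _)
theorem fun_assoc {A B D K : InternalCat C} (F : A ⟶ B) (G : B ⟶ D) (H : D ⟶ K) :
    (F ≫ G) ≫ H = F ≫ G ≫ H :=
  Fun.ext (Category.assoc _ _ _) (Category.assoc _ _ _)

theorem whiskerL_eqToHom {A B D : InternalCat C} (F : A ⟶ B) {G H : B ⟶ D} (h : G = H) :
    whiskerL F (eqToHom h) = eqToHom (by rw [h]) := by
  subst h; ext; simp
theorem whiskerR_eqToHom {A B D : InternalCat C} {F G : A ⟶ B} (h : F = G) (H : B ⟶ D) :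
    whiskerR (eqToHom h) H = eqToHom (by rw [h]) := by
  subst h; ext; simp [Fun.ident_arr]

/-- The 2-category of internal categories, internal functors and internal natural
transformations. -/
instance bicategory : Bicategory (InternalCat C) where
  homCategory := homCat
  whiskerLeft F _ _ α := whiskerL F α
  whiskerRight α H := whiskerR α H
  associator F G H := eqToIso (fun_assoc F G H)
  leftUnitor F := eqToIso (fun_id_comp F)
  rightUnitor F := eqToIso (fun_comp_id F)
  whiskerLeft_id F G := by ext; simp
  whiskerLeft_comp F _ _ _ α β := by
    ext; simp only [whiskerL_app, comp_app, pre_cmp]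
  id_whiskerLeft α := by
    ext; simp [eqToHom_comp_app, comp_eqToHom_app]
  comp_whiskerLeft F G _ _ α := by
    ext; simp [eqToHom_comp_app, comp_eqToHom_app]
  id_whiskerRight F G := by
    ext; simp [Fun.ident_arr]
  comp_whiskerRight α β H := by
    ext; simp only [whiskerR_app, comp_app, Fun.cmp_arr]
  whiskerRight_id α := by
    ext; simp [eqToHom_comp_app, comp_eqToHom_app]
  whiskerRight_comp α G H := by
    ext; simp [eqToHom_comp_app, comp_eqToHom_app]
  whisker_assoc F _ _ α H := by
    ext; simp [eqToHom_comp_app, comp_eqToHom_app]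
  whisker_exchange {A B D} {F G H K} α β := by
    ext
    simp only [comp_app, whiskerL_app, whiskerR_app]
    exact (β.nat α.app _ _ α.app_dom α.app_cod).symm
  pentagon F G H K := by
    simp [whiskerR_eqToHom, whiskerL_eqToHom]
  triangle F G := by
    simp [whiskerR_eqToHom, whiskerL_eqToHom]

instance strict : Bicategory.Strict (InternalCat C) where
  id_comp := fun_id_comp
  comp_id := fun_comp_id
  assoc := fun_assoc
  leftUnitor_eqToIso _ := rfl
  rightUnitor_eqToIso _ := rfl
  associator_eqToIso _ _ _ := rfl

end InternalCat

/-! ## Internal full subcategories -/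

namespace FullSub

open ChosenPullbacksAlong renaming fst → pfst, snd → psnd, lift → plift

open ChosenPullbacksAlong (pullbackObj)

variable {C : Type u} [Category.{v} C] [LCCC C]

theorem pext {X Y Z W : C} {f : Y ⟶ X} {g : Z ⟶ X} {p q : W ⟶ pullbackObj f g}
    (h₁ : p ≫ pfst f g = q ≫ pfst f g) (h₂ : p ≫ psnd f g = q ≫ psnd f g) : p = q :=
  ChosenPullbacksAlong.hom_ext f g h₁ h₂

theorem plift_fst {X Y Z W : C} {f : Y ⟶ X} {g : Z ⟶ X} (a : W ⟶ Y) (b : W ⟶ Z)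
    (h : a ≫ f = b ≫ g) : plift a b h ≫ pfst f g = a := ChosenPullbacksAlong.lift_fst a b h

theorem plift_snd {X Y Z W : C} {f : Y ⟶ X} {g : Z ⟶ X} (a : W ⟶ Y) (b : W ⟶ Z)
    (h : a ≫ f = b ≫ g) : plift a b h ≫ psnd f g = b := ChosenPullbacksAlong.lift_snd a b h

theorem pcond {X Y Z : C} (f : Y ⟶ X) (g : Z ⟶ X) : pfst f g ≫ f = psnd f g ≫ g :=
  ChosenPullbacksAlong.condition

theorem pre_plift {X Y Z W V : C} {f : Y ⟶ X} {g : Z ⟶ X} (x : V ⟶ W) (a : W ⟶ Y) (b : W ⟶ Z)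
    (h : a ≫ f = b ≫ g) : x ≫ plift a b h = plift (x ≫ a) (x ≫ b) (by simp [h]) :=
  pext (by simp) (by simp)

theorem plift_congr {X Y Z W : C} {f : Y ⟶ X} {g : Z ⟶ X} {a a' : W ⟶ Y} {b b' : W ⟶ Z}
    (ha : a = a') (hb : b = b') (h : a ≫ f = b ≫ g) :
    plift a b h = plift a' b' (by rw [← ha, ← hb, h]) := by
  subst ha hb; rfl

section Exponential

variable {X : C} (Y Z : Over X)

/-- The exponential `Z ^ Y` in the slice over `X`, namely `Π_y Δ_y Z` where `y` is the structure
morphism of `Y`. -/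
def expo : Over X :=
  (ExponentiableMorphism.pushforward Y.hom).obj ((ChosenPullbacksAlong.pullback Y.hom).obj Z)

/-- The counit of `Δ_y ⊣ Π_y` at `Δ_y Z`. -/
def counit : pullbackObj (expo Y Z).hom Y.hom ⟶ pullbackObj Z.hom Y.hom :=
  ((ExponentiableMorphism.ev Y.hom).app ((ChosenPullbacksAlong.pullback Y.hom).obj Z)).left

theorem counit_snd : counit Y Z ≫ psnd Z.hom Y.hom = psnd (expo Y Z).hom Y.hom :=
  Over.w ((ExponentiableMorphism.ev Y.hom).app ((ChosenPullbacksAlong.pullback Y.hom).obj Z))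

/-- The evaluation map `Z ^ Y × Y ⟶ Z` over `X`. -/
def expoEv : pullbackObj (expo Y Z).hom Y.hom ⟶ Z.left := counit Y Z ≫ pfst Z.hom Y.hom

theorem expoEv_hom : expoEv Y Z ≫ Z.hom = psnd (expo Y Z).hom Y.hom ≫ Y.hom := by
  rw [expoEv, Category.assoc, ChosenPullbacksAlong.condition, ← Category.assoc, counit_snd]

variable {Y Z} {W : Over X}

/-- The morphism `Δ_y W ⟶ Δ_y Z` given by a morphism `W × Y ⟶ Z` over `X`. -/
def toPull (w : pullbackObj W.hom Y.hom ⟶ Z.left) (hw : w ≫ Z.hom = psnd W.hom Y.hom ≫ Y.hom) :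
    (ChosenPullbacksAlong.pullback Y.hom).obj W ⟶ (ChosenPullbacksAlong.pullback Y.hom).obj Z :=
  Over.homMk (plift w (psnd W.hom Y.hom) hw : pullbackObj W.hom Y.hom ⟶ pullbackObj Z.hom Y.hom)
    (ChosenPullbacksAlong.lift_snd _ _ _)

/-- The exponential transpose of a morphism `W × Y ⟶ Z` over `X`. -/
def expoCurry (w : pullbackObj W.hom Y.hom ⟶ Z.left)
    (hw : w ≫ Z.hom = psnd W.hom Y.hom ≫ Y.hom) : W ⟶ expo Y Z :=
  ExponentiableMorphism.pushforwardCurry (toPull w hw)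

/-- The action of `k × Y` on the first factor. -/
def mapFst (k : W ⟶ expo Y Z) : pullbackObj W.hom Y.hom ⟶ pullbackObj (expo Y Z).hom Y.hom :=
  plift (pfst W.hom Y.hom ≫ k.left) (psnd W.hom Y.hom) (by
    rw [Category.assoc, Over.w k, ChosenPullbacksAlong.condition])

theorem pullback_map_left (k : W ⟶ expo Y Z) :
    ((ChosenPullbacksAlong.pullback Y.hom).map k).left = mapFst k := by
  refine pext ?_ ?_
  · have := congrArg CommaMorphism.left
      ((ChosenPullbacksAlong.mapPullbackAdj Y.hom).counit.naturality k)
    exact this.trans (plift_fst _ _ _).symm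
  · exact (Over.w ((ChosenPullbacksAlong.pullback Y.hom).map k)).trans (plift_snd _ _ _).symm

theorem uncurry_left (k : W ⟶ expo Y Z) :
    (ExponentiableMorphism.pushforwardUncurry k).left = mapFst k ≫ counit Y Z := by
  rw [← pullback_map_left]
  exact congrArg CommaMorphism.left
    ((ExponentiableMorphism.pullbackPushforwardAdj Y.hom).homEquiv_counit (g := k))

theorem expoCurry_ev (w : pullbackObj W.hom Y.hom ⟶ Z.left)
    (hw : w ≫ Z.hom = psnd W.hom Y.hom ≫ Y.hom) : mapFst (expoCurry w hw) ≫ expoEv Y Z = w := by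
  rw [expoEv, ← Category.assoc, ← uncurry_left, expoCurry,
    ExponentiableMorphism.pushforward_uncurry_curry]
  exact plift_fst w _ hw

theorem plift_mapFst (k : W ⟶ expo Y Z) {V : C} (x : V ⟶ W.left) (y : V ⟶ Y.left)
    (h : x ≫ W.hom = y ≫ Y.hom) :
    plift x y h ≫ mapFst k = plift (x ≫ k.left) y (by rw [Category.assoc, Over.w k, h]) := by
  rw [mapFst, pre_plift]
  exact plift_congr (by rw [← Category.assoc, plift_fst]) (plift_snd _ _ _) _

theorem expo_ext {k k' : W ⟶ expo Y Z} (h : mapFst k ≫ expoEv Y Z = mapFst k' ≫ expoEv Y Z) :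
    k = k' := by
  rw [← ExponentiableMorphism.pushforward_curry_uncurry k,
    ← ExponentiableMorphism.pushforward_curry_uncurry k']
  congr 1
  apply Over.OverMorphism.ext
  rw [uncurry_left, uncurry_left]
  refine pext ?_ ?_
  · simpa only [expoEv, Category.assoc] using h
  · simp only [Category.assoc, counit_snd]
    rw [mapFst, mapFst, plift_snd, plift_snd]

end Exponential

section

variable {B A : C} (f : B ⟶ A)

/-- The pullback of `f` along the first projection `A × A ⟶ A`, as an object over `A × A`. -/
def f₁ : Over (A ⊗ A) := (ChosenPullbacksAlong.pullback (fst A A)).obj (Over.mk f)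

/-- The pullback of `f` along the second projection `A × A ⟶ A`, as an object over `A × A`. -/
def f₂ : Over (A ⊗ A) := (ChosenPullbacksAlong.pullback (snd A A)).obj (Over.mk f)

/-- The object of arrows `∑ (a a' : A), B_{a'} ^ B_a`, that is, the exponential of the two pullbacks
of `f` in the slice over `A × A`. -/
abbrev Arr : C := (expo (f₁ f) (f₂ f)).left

/-- The structure morphism `⟨∂₀, ∂₁⟩` of the exponential. -/
abbrev bdry : Arr f ⟶ A ⊗ A := (expo (f₁ f) (f₂ f)).hom

def dom : Arr f ⟶ A := bdry f ≫ fst A A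
def cod : Arr f ⟶ A := bdry f ≫ snd A A

/-- An element of the pullback of `f` along the first projection. -/
def mk₁ {X : C} (b : X ⟶ B) (c : X ⟶ A ⊗ A) (h : b ≫ f = c ≫ fst A A) : X ⟶ (f₁ f).left :=
  plift (f := f) (g := fst A A) b c h

theorem mk₁_hom {X : C} (b : X ⟶ B) (c : X ⟶ A ⊗ A) (h : b ≫ f = c ≫ fst A A) :
    mk₁ f b c h ≫ (f₁ f).hom = c := ChosenPullbacksAlong.lift_snd _ _ _

/-- An element of the pullback of `f` along the second projection. -/
def mk₂ {X : C} (b : X ⟶ B) (c : X ⟶ A ⊗ A) (h : b ≫ f = c ≫ snd A A) : X ⟶ (f₂ f).left :=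
  plift (f := f) (g := snd A A) b c h

theorem mk₂_hom {X : C} (b : X ⟶ B) (c : X ⟶ A ⊗ A) (h : b ≫ f = c ≫ snd A A) :
    mk₂ f b c h ≫ (f₂ f).hom = c := ChosenPullbacksAlong.lift_snd _ _ _

theorem pre_mk₁ {X Y : C} (x : Y ⟶ X) (b : X ⟶ B) (c : X ⟶ A ⊗ A) (h : b ≫ f = c ≫ fst A A) :
    x ≫ mk₁ f b c h = mk₁ f (x ≫ b) (x ≫ c) (by simp [h]) := pre_plift _ _ _ _

theorem mk₁_congr {X : C} {b b' : X ⟶ B} {c c' : X ⟶ A ⊗ A} (hb : b = b') (hc : c = c')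
    (h : b ≫ f = c ≫ fst A A) : mk₁ f b c h = mk₁ f b' c' (by rw [← hb, ← hc, h]) :=
  plift_congr hb hc _

/-- The projections of the two pullbacks to `B`. -/
def pr₁ : (f₁ f).left ⟶ B := pfst f (fst A A)
def pr₂ : (f₂ f).left ⟶ B := pfst f (snd A A)

theorem pr₁_f : pr₁ f ≫ f = (f₁ f).hom ≫ fst A A := ChosenPullbacksAlong.condition
theorem pr₂_f : pr₂ f ≫ f = (f₂ f).hom ≫ snd A A := ChosenPullbacksAlong.condition
theorem mk₁_pr₁ {X : C} (b : X ⟶ B) (c : X ⟶ A ⊗ A) (h : b ≫ f = c ≫ fst A A) :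
    mk₁ f b c h ≫ pr₁ f = b := ChosenPullbacksAlong.lift_fst _ _ _
theorem mk₂_pr₂ {X : C} (b : X ⟶ B) (c : X ⟶ A ⊗ A) (h : b ≫ f = c ≫ snd A A) :
    mk₂ f b c h ≫ pr₂ f = b := ChosenPullbacksAlong.lift_fst _ _ _

theorem ext₁ {X : C} {p q : X ⟶ (f₁ f).left} (h₁ : p ≫ pr₁ f = q ≫ pr₁ f)
    (h₂ : p ≫ (f₁ f).hom = q ≫ (f₁ f).hom) : p = q := pext h₁ h₂
theorem ext₂ {X : C} {p q : X ⟶ (f₂ f).left} (h₁ : p ≫ pr₂ f = q ≫ pr₂ f)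
    (h₂ : p ≫ (f₂ f).hom = q ≫ (f₂ f).hom) : p = q := pext h₁ h₂

/-- Evaluation `(k, b) ↦ k b` of generalised elements: `k` is an arrow and `b` is an element of the
fibre of `f` over the domain of `k`. -/
def ap {X : C} (k : X ⟶ Arr f) (b : X ⟶ B) (h : b ≫ f = k ≫ dom f) : X ⟶ B :=
  plift (f := bdry f) (g := (f₁ f).hom) k
    (mk₁ f b (k ≫ bdry f) (h.trans (Category.assoc _ _ _).symm)) (mk₁_hom _ _ _ _).symm ≫
    expoEv (f₁ f) (f₂ f) ≫ pr₂ f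

theorem ap_f {X : C} (k : X ⟶ Arr f) (b : X ⟶ B) (h : b ≫ f = k ≫ dom f) :
    ap f k b h ≫ f = k ≫ cod f := by
  rw [ap, Category.assoc, Category.assoc, pr₂_f, ← Category.assoc (expoEv _ _), expoEv_hom,
    Category.assoc, ← Category.assoc (plift _ _ _), plift_snd, ← Category.assoc, mk₁_hom,
    Category.assoc, cod]

theorem ap_congr {X : C} {k k' : X ⟶ Arr f} {b b' : X ⟶ B} (hk : k = k') (hb : b = b')
    (h : b ≫ f = k ≫ dom f) : ap f k b h = ap f k' b' (by rw [← hk, ← hb, h]) := by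
  subst hk hb; rfl

theorem pre_ap {X Y : C} (x : Y ⟶ X) (k : X ⟶ Arr f) (b : X ⟶ B) (h : b ≫ f = k ≫ dom f) :
    x ≫ ap f k b h = ap f (x ≫ k) (x ≫ b) (by simp [h]) := by
  rw [ap, ap, ← Category.assoc]
  congr 1
  rw [pre_plift]
  refine plift_congr rfl ?_ _
  rw [pre_mk₁]
  exact mk₁_congr _ rfl (Category.assoc _ _ _).symm _

/-- A family of maps `u x : B_{a x} ⟶ B_{a' x}` as a morphism over `A × A`. -/
def family {X : C} (a a' : X ⟶ A) (u : pullbackObj f a ⟶ B) (hu : u ≫ f = psnd f a ≫ a') :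
    pullbackObj (lift a a') (f₁ f).hom ⟶ (f₂ f).left :=
  mk₂ f
    (plift (f := f) (g := a) (psnd (lift a a') (f₁ f).hom ≫ pr₁ f) (pfst (lift a a') (f₁ f).hom)
      (by rw [Category.assoc, pr₁_f, ← Category.assoc, ← pcond, Category.assoc, lift_fst]) ≫ u)
    (psnd (lift a a') (f₁ f).hom ≫ (f₁ f).hom)
    (by rw [Category.assoc, hu, ← Category.assoc, plift_snd, ← pcond, Category.assoc, lift_snd])

/-- The transpose of a family of maps, over `A × A`. -/
def curryOver {X : C} (a a' : X ⟶ A) (u : pullbackObj f a ⟶ B) (hu : u ≫ f = psnd f a ≫ a') :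
    Over.mk (lift a a') ⟶ expo (f₁ f) (f₂ f) :=
  expoCurry (W := Over.mk (lift a a')) (Y := f₁ f) (Z := f₂ f) (family f a a' u hu)
    (mk₂_hom _ _ _ _)

/-- The transpose `X ⟶ ∑ (a a' : A), B_{a'} ^ B_a` of a family of maps `u x : B_{a x} ⟶ B_{a' x}`
indexed by `x : X`. -/
def curry {X : C} (a a' : X ⟶ A) (u : pullbackObj f a ⟶ B) (hu : u ≫ f = psnd f a ≫ a') :
    X ⟶ Arr f :=
  (curryOver f a a' u hu).left

theorem curry_bdry {X : C} (a a' : X ⟶ A) (u : pullbackObj f a ⟶ B)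
    (hu : u ≫ f = psnd f a ≫ a') : curry f a a' u hu ≫ bdry f = lift a a' :=
  Over.w (curryOver f a a' u hu)

@[simp]
theorem curry_dom {X : C} (a a' : X ⟶ A) (u : pullbackObj f a ⟶ B)
    (hu : u ≫ f = psnd f a ≫ a') : curry f a a' u hu ≫ dom f = a := by
  rw [dom, ← Category.assoc, curry_bdry, lift_fst]

@[simp]
theorem curry_cod {X : C} (a a' : X ⟶ A) (u : pullbackObj f a ⟶ B)
    (hu : u ≫ f = psnd f a ≫ a') : curry f a a' u hu ≫ cod f = a' := by
  rw [cod, ← Category.assoc, curry_bdry, lift_snd]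

theorem ap_curry {X Y : C} (a a' : X ⟶ A) (u : pullbackObj f a ⟶ B)
    (hu : u ≫ f = psnd f a ≫ a') (x : Y ⟶ X) (b : Y ⟶ B)
    (h : b ≫ f = (x ≫ curry f a a' u hu) ≫ dom f) :
    ap f (x ≫ curry f a a' u hu) b h =
      plift b x (by rw [h, Category.assoc, curry_dom]) ≫ u := by
  have h' : b ≫ f = (x ≫ lift a a') ≫ fst A A := by
    rw [h, Category.assoc, curry_dom, Category.assoc, lift_fst]
  have hW : x ≫ lift a a' = mk₁ f b (x ≫ lift a a') h' ≫ (f₁ f).hom := (mk₁_hom _ _ _ _).symm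
  have h₁ := plift_mapFst (curryOver f a a' u hu) x (mk₁ f b (x ≫ lift a a') h') hW
  have h₂ : mapFst (curryOver f a a' u hu) ≫ expoEv (f₁ f) (f₂ f) = family f a a' u hu :=
    expoCurry_ev (W := Over.mk (lift a a')) _ _
  have h₃ : plift (f := bdry f) (g := (f₁ f).hom) (x ≫ curry f a a' u hu)
      (mk₁ f b ((x ≫ curry f a a' u hu) ≫ bdry f) (h.trans (Category.assoc _ _ _).symm))
      (mk₁_hom _ _ _ _).symm =
      plift (f := lift a a') (g := (f₁ f).hom) x (mk₁ f b (x ≫ lift a a') h') hW ≫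
        mapFst (curryOver f a a' u hu) := by
    refine Eq.trans (plift_congr rfl ?_ _) h₁.symm
    exact mk₁_congr _ rfl (by rw [Category.assoc, curry_bdry]) _
  rw [ap, h₃, Category.assoc, ← Category.assoc (mapFst _)]
  refine (congrArg (fun t => _ ≫ t ≫ pr₂ f) h₂).trans ?_
  rw [family, mk₂_pr₂, ← Category.assoc, pre_plift]
  congr 1
  refine plift_congr ?_ (plift_fst _ _ _) _
  rw [← Category.assoc, plift_snd, mk₁_pr₁]

theorem arr_ext {X : C} {k k' : X ⟶ Arr f} (hd : k ≫ dom f = k' ≫ dom f)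
    (hc : k ≫ cod f = k' ≫ cod f)
    (h : ∀ {Y : C} (x : Y ⟶ X) (b : Y ⟶ B) (hb : b ≫ f = (x ≫ k) ≫ dom f),
      ap f (x ≫ k) b hb = ap f (x ≫ k') b (by rw [hb, Category.assoc, hd, Category.assoc])) :
    k = k' := by
  have hb : k ≫ bdry f = k' ≫ bdry f := by
    ext
    · simpa only [Category.assoc, dom] using hd
    · simpa only [Category.assoc, cod] using hc
  let W : Over (A ⊗ A) := Over.mk (k ≫ bdry f)
  let K : W ⟶ expo (f₁ f) (f₂ f) := Over.homMk k
  let K' : W ⟶ expo (f₁ f) (f₂ f) := Over.homMk k' hb.symm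
  suffices K = K' from congrArg CommaMorphism.left this
  have hp : pfst W.hom (f₁ f).hom ≫ W.hom = psnd W.hom (f₁ f).hom ≫ (f₁ f).hom := pcond _ _
  have hw : (pfst W.hom (f₁ f).hom ≫ k) ≫ bdry f = psnd W.hom (f₁ f).hom ≫ (f₁ f).hom :=
    (Category.assoc _ _ _).trans hp
  have hw' : (pfst W.hom (f₁ f).hom ≫ k') ≫ bdry f = psnd W.hom (f₁ f).hom ≫ (f₁ f).hom := by
    rw [Category.assoc, ← hb]; exact hp
  have hd' : (psnd W.hom (f₁ f).hom ≫ pr₁ f) ≫ f = (pfst W.hom (f₁ f).hom ≫ k) ≫ dom f := by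
    rw [Category.assoc, pr₁_f, ← Category.assoc, ← hw, dom, Category.assoc]
  have main := h (pfst W.hom (f₁ f).hom) (psnd W.hom (f₁ f).hom ≫ pr₁ f) hd'
  apply expo_ext
  refine ext₂ f ?_ ?_
  · refine Eq.trans ?_ (main.trans ?_)
    · refine (Category.assoc _ _ _).trans (congrArg (· ≫ expoEv (f₁ f) (f₂ f) ≫ pr₂ f) ?_)
      exact plift_congr rfl
        (ext₁ f (mk₁_pr₁ f _ _ _).symm (hw.symm.trans (mk₁_hom f _ _ _).symm)) _
    · refine Eq.trans (congrArg (· ≫ expoEv (f₁ f) (f₂ f) ≫ pr₂ f) ?_) (Category.assoc _ _ _).symm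
      exact plift_congr rfl
        (ext₁ f (mk₁_pr₁ f _ _ _) ((mk₁_hom f _ _ _).trans hw')) _
  · rw [Category.assoc, Category.assoc, expoEv_hom, ← Category.assoc, ← Category.assoc, mapFst,
      mapFst, plift_snd, plift_snd]

/-- The identity arrows. -/
def ident : A ⟶ Arr f := curry f (𝟙 A) (𝟙 A) (pfst f (𝟙 A)) (pcond _ _)

theorem ap_ident {X : C} (a : X ⟶ A) (b : X ⟶ B) (h : b ≫ f = (a ≫ ident f) ≫ dom f) :
    ap f (a ≫ ident f) b h = b := by
  have := ap_curry f (𝟙 A) (𝟙 A) (pfst f (𝟙 A)) (pcond _ _) a b h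
  exact this.trans (plift_fst _ _ _)

/-- The family of maps `b ↦ l (k b)` indexed by composable pairs of arrows `(k, l)`. -/
def compFamily : pullbackObj f (pfst (cod f) (dom f) ≫ dom f) ⟶ B :=
  ap f (psnd f (pfst (cod f) (dom f) ≫ dom f) ≫ psnd (cod f) (dom f))
    (ap f (psnd f (pfst (cod f) (dom f) ≫ dom f) ≫ pfst (cod f) (dom f))
      (pfst f (pfst (cod f) (dom f) ≫ dom f)) (by rw [pcond, Category.assoc]))
    (by rw [ap_f, Category.assoc, pcond, Category.assoc])

/-- Composition of arrows. -/
def comp : pullbackObj (cod f) (dom f) ⟶ Arr f :=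
  curry f (pfst (cod f) (dom f) ≫ dom f) (psnd (cod f) (dom f) ≫ cod f) (compFamily f)
    (by rw [compFamily, ap_f, Category.assoc])

theorem ap_comp {X : C} (k l : X ⟶ Arr f) (hkl : k ≫ cod f = l ≫ dom f) (m : X ⟶ Arr f)
    (hm : m = plift k l hkl ≫ comp f) (b : X ⟶ B) (h : b ≫ f = m ≫ dom f)
    (h' : b ≫ f = k ≫ dom f) :
    ap f m b h = ap f l (ap f k b h') (by rw [ap_f, hkl]) := by
  subst hm
  refine (ap_curry f _ _ (compFamily f) _ (plift k l hkl) b h).trans ?_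
  refine (pre_ap f _ _ _ _).trans ?_
  refine ap_congr f ?_ ?_ _
  · rw [← Category.assoc, plift_snd, plift_snd]
  · rw [pre_ap]
    refine ap_congr f ?_ (plift_fst _ _ _) _
    rw [← Category.assoc, plift_snd, plift_fst]

theorem ident_dom : ident f ≫ dom f = 𝟙 A := curry_dom _ _ _ _ _
theorem ident_cod : ident f ≫ cod f = 𝟙 A := curry_cod _ _ _ _ _
theorem comp_dom : comp f ≫ dom f = pfst (cod f) (dom f) ≫ dom f := curry_dom _ _ _ _ _
theorem comp_cod : comp f ≫ cod f = psnd (cod f) (dom f) ≫ cod f := curry_cod _ _ _ _ _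

theorem lift_comp_dom {X : C} (k l : X ⟶ Arr f) (h : k ≫ cod f = l ≫ dom f) :
    (plift k l h ≫ comp f) ≫ dom f = k ≫ dom f := by
  rw [Category.assoc, comp_dom, ← Category.assoc, plift_fst]

theorem lift_comp_cod {X : C} (k l : X ⟶ Arr f) (h : k ≫ cod f = l ≫ dom f) :
    (plift k l h ≫ comp f) ≫ cod f = l ≫ cod f := by
  rw [Category.assoc, comp_cod, ← Category.assoc, plift_snd]

theorem pre_comp {X Y : C} (x : Y ⟶ X) (k l : X ⟶ Arr f) (h : k ≫ cod f = l ≫ dom f) :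
    x ≫ plift k l h ≫ comp f = plift (x ≫ k) (x ≫ l) (by simp [h]) ≫ comp f := by
  rw [← Category.assoc, pre_plift]

end

/-- The internal full subcategory associated with `f : B ⟶ A`: its object of objects is `A`, its
object of arrows is `∑ (a a' : A), B_{a'} ^ B_a`, with the evident identities and composition. -/
def full {B A : C} (f : B ⟶ A) : InternalCat C where
  Ob := A
  Arr := Arr f
  dom := dom f
  cod := cod f
  ident := ident f
  comp := comp f
  ident_dom := ident_dom f
  ident_cod := ident_cod f
  comp_dom := comp_dom f
  comp_cod := comp_cod f
  id_comp := by
    refine arr_ext f ?_ ?_ ?_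
    · rw [lift_comp_dom, Category.assoc, ident_dom, Category.comp_id, Category.id_comp]
    · rw [lift_comp_cod]
    · intro Y x b hb
      have hb' : b ≫ f = x ≫ dom f := by
        rw [hb, Category.assoc, lift_comp_dom, Category.assoc, ident_dom, Category.comp_id]
      refine (ap_comp f (x ≫ dom f ≫ ident f) (x ≫ 𝟙 _)
        (by simp [ident_cod]) _ (pre_comp f _ _ _ _) b hb (by simpa [ident_dom] using hb')).trans ?_
      refine ap_congr f rfl ?_ _
      rw [ap_congr f (Category.assoc _ _ _).symm rfl]
      exact ap_ident f _ _ _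
  comp_id := by
    refine arr_ext f ?_ ?_ ?_
    · rw [lift_comp_dom]
    · rw [lift_comp_cod, Category.assoc, ident_cod, Category.comp_id, Category.id_comp]
    · intro Y x b hb
      have hb' : b ≫ f = x ≫ dom f := by
        rw [hb, Category.assoc, lift_comp_dom, Category.id_comp]
      refine (ap_comp f (x ≫ 𝟙 _) (x ≫ cod f ≫ ident f)
        (by simp [ident_dom]) _ (pre_comp f _ _ _ _) b hb (by simpa using hb')).trans ?_
      rw [ap_congr f (Category.assoc _ _ _).symm rfl]
      exact ap_ident f _ _ _
  assoc {X} k l m h₁ h₂ := by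
    refine arr_ext f ?_ ?_ ?_
    · simp only [lift_comp_dom]
    · simp only [lift_comp_cod]
    · intro Y x b hb
      have hb' : b ≫ f = (x ≫ k) ≫ dom f := by
        rw [hb, Category.assoc, lift_comp_dom, lift_comp_dom, Category.assoc]
      have e₁ : (x ≫ k) ≫ cod f = (x ≫ l) ≫ dom f := by rw [Category.assoc, h₁, Category.assoc]
      have e₂ : (x ≫ l) ≫ cod f = (x ≫ m) ≫ dom f := by rw [Category.assoc, h₂, Category.assoc]
      have d₁ : (x ≫ plift k l h₁ ≫ comp f) ≫ cod f = (x ≫ m) ≫ dom f := by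
        rw [Category.assoc, lift_comp_cod, Category.assoc, h₂]
      have d₂ : (x ≫ k) ≫ cod f = (x ≫ plift l m h₂ ≫ comp f) ≫ dom f := by
        rw [Category.assoc, Category.assoc, lift_comp_dom, h₁]
      rw [ap_comp f _ _ d₁ _ (pre_comp f _ _ _ _) b hb
          (by rw [hb', Category.assoc, Category.assoc, lift_comp_dom]),
        ap_comp f _ _ d₂ _ (pre_comp f _ _ _ _) b _ hb',
        ap_comp f _ _ e₂ _ (pre_comp f _ _ _ _) (ap f (x ≫ k) b hb') _ (by rw [ap_f, e₁])]
      exact ap_congr f rfl (ap_comp f _ _ e₁ _ (pre_comp f _ _ _ _) b _ hb') _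

section Functor

variable {B A D K : C} {p : B ⟶ D} {f : B ⟶ A} {g : D ⟶ K} {q : A ⟶ K}

/-- Given a pullback square `B = A ×_K D`, the family of maps sending `d` in the fibre of `g` over
`q (∂₀ k)` to `p (k (∂₀ k, d))`, indexed by the arrows `k`. -/
def mapFamily (sq : IsPullback p f g q) : pullbackObj g (dom f ≫ q) ⟶ D :=
  ap f (psnd g (dom f ≫ q))
    (sq.lift (pfst g (dom f ≫ q)) (psnd g (dom f ≫ q) ≫ dom f) (by rw [pcond, Category.assoc]))
    (sq.lift_snd _ _ _) ≫ p

theorem mapFamily_g (sq : IsPullback p f g q) :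
    mapFamily sq ≫ g = psnd g (dom f ≫ q) ≫ cod f ≫ q := by
  rw [mapFamily, Category.assoc, sq.w, ← Category.assoc, ap_f, Category.assoc]

/-- The action on arrows of the internal functor induced by a pullback square. -/
def mapArr (sq : IsPullback p f g q) : Arr f ⟶ Arr g :=
  curry g (dom f ≫ q) (cod f ≫ q) (mapFamily sq) (mapFamily_g sq)

theorem mapArr_dom (sq : IsPullback p f g q) : mapArr sq ≫ dom g = dom f ≫ q :=
  curry_dom _ _ _ _ _
theorem mapArr_cod (sq : IsPullback p f g q) : mapArr sq ≫ cod g = cod f ≫ q :=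
  curry_cod _ _ _ _ _

theorem ap_mapArr (sq : IsPullback p f g q) {X : C} (k : X ⟶ Arr f) (d : X ⟶ D)
    (h : d ≫ g = (k ≫ mapArr sq) ≫ dom g) (b : X ⟶ B) (hb : b ≫ p = d)
    (hb' : b ≫ f = k ≫ dom f) :
    ap g (k ≫ mapArr sq) d h = ap f k b hb' ≫ p := by
  refine (ap_curry g _ _ (mapFamily sq) _ k d h).trans ?_
  refine (Category.assoc _ _ _).symm.trans (congrArg (· ≫ p) ?_)
  refine (pre_ap f _ _ _ _).trans ?_
  refine ap_congr f (plift_snd _ _ _) ?_ _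
  apply sq.hom_ext
  · rw [Category.assoc, sq.lift_fst, plift_fst, hb]
  · rw [Category.assoc, sq.lift_snd, ← Category.assoc, plift_snd, hb']

/-- The internal functor between internal full subcategories induced by a pullback square. -/
def mapFun (sq : IsPullback p f g q) : full f ⟶ full g :=
  InternalCat.Fun.mk (A := full f) (B := full g) q (mapArr sq) (mapArr_dom sq) (mapArr_cod sq)
    (by
      change ident f ≫ mapArr sq = q ≫ ident g
      refine arr_ext g ?_ ?_ ?_
      · rw [Category.assoc, mapArr_dom, Category.assoc, ident_dom, ← Category.assoc, ident_dom,
          Category.id_comp, Category.comp_id]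
      · rw [Category.assoc, mapArr_cod, Category.assoc, ident_cod, ← Category.assoc, ident_cod,
          Category.id_comp, Category.comp_id]
      · intro Y x d hd
        have hd' : d ≫ g = x ≫ q := by
          rw [hd, Category.assoc, Category.assoc, mapArr_dom, ← Category.assoc (ident f), ident_dom,
            Category.id_comp]
        have hx : ((x ≫ ident f) ≫ mapArr sq) = x ≫ ident f ≫ mapArr sq := Category.assoc _ _ _
        rw [ap_congr g hx.symm rfl,
          ap_mapArr sq (x ≫ ident f) d _ (sq.lift d x hd') (sq.lift_fst _ _ _)
            (by rw [sq.lift_snd, Category.assoc, ident_dom, Category.comp_id]),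
          ap_ident, sq.lift_fst, ap_congr g (Category.assoc x q (ident g)).symm rfl, ap_ident])
    (by
      have hkl : pfst (cod f) (dom f) ≫ cod f = psnd (cod f) (dom f) ≫ dom f := pcond _ _
      have hkl' : (pfst (cod f) (dom f) ≫ mapArr sq) ≫ cod g =
          (psnd (cod f) (dom f) ≫ mapArr sq) ≫ dom g := by
        rw [Category.assoc, mapArr_cod, Category.assoc, mapArr_dom, ← Category.assoc, hkl,
          Category.assoc]
      suffices comp f ≫ mapArr sq =
        plift (pfst (cod f) (dom f) ≫ mapArr sq) (psnd (cod f) (dom f) ≫ mapArr sq) hkl' ≫ comp g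
        from this
      refine arr_ext g ?_ ?_ ?_
      · rw [lift_comp_dom, Category.assoc, mapArr_dom, ← Category.assoc, comp_dom, Category.assoc,
          Category.assoc, mapArr_dom]
      · rw [lift_comp_cod, Category.assoc, mapArr_cod, ← Category.assoc, comp_cod, Category.assoc,
          Category.assoc, mapArr_cod]
      · intro Y x d hd
        have hd' : d ≫ g = ((x ≫ pfst (cod f) (dom f)) ≫ dom f) ≫ q := by
          rw [hd, Category.assoc, Category.assoc, mapArr_dom, ← Category.assoc (comp f), comp_dom]
          simp only [Category.assoc]
        have hc : x ≫ comp f = plift (x ≫ pfst (cod f) (dom f)) (x ≫ psnd (cod f) (dom f))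
            (by rw [Category.assoc, hkl, Category.assoc]) ≫ comp f := by
          rw [← pre_plift x _ _ hkl, Category.assoc]
          congr 1
          rw [show plift (pfst (cod f) (dom f)) (psnd (cod f) (dom f)) hkl = 𝟙 _ from
            pext (by rw [plift_fst, Category.id_comp]) (by rw [plift_snd, Category.id_comp]),
            Category.id_comp]
        have l₁ := sq.lift_fst d _ hd'
        have l₂ := sq.lift_snd d _ hd'
        have m₁ : x ≫ pfst (cod f) (dom f) ≫ mapArr sq = (x ≫ pfst (cod f) (dom f)) ≫ mapArr sq :=
          (Category.assoc _ _ _).symm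
        have m₂ : x ≫ psnd (cod f) (dom f) ≫ mapArr sq = (x ≫ psnd (cod f) (dom f)) ≫ mapArr sq :=
          (Category.assoc _ _ _).symm
        rw [ap_congr g (Category.assoc x (comp f) (mapArr sq)).symm rfl,
          ap_mapArr sq (x ≫ comp f) d _ _ l₁ (by
            rw [l₂, Category.assoc, Category.assoc, comp_dom]),
          ap_comp f _ _ _ _ hc _ _ l₂,
          ap_comp g _ _ _ _ (pre_comp g _ _ _ _) d _ (by rw [hd', m₁, Category.assoc _ (mapArr sq),
            mapArr_dom, ← Category.assoc]),
          ap_congr g m₂ (ap_congr g m₁ rfl _),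
          ap_congr g rfl (ap_mapArr sq _ d _ _ l₁ l₂)]
        exact (ap_mapArr sq _ _ _ _ rfl _).symm)

end Functor

end FullSub

/-! ## Polynomials -/

/-- A polynomial `I ⟵ B ⟶ A ⟶ J` from `I` to `J`. -/
structure Polyn {E : Type u} [Category.{v} E] (I J : E) where
  B : E
  A : E
  s : B ⟶ I
  f : B ⟶ A
  t : A ⟶ J

namespace Polyn

open ChosenPullbacksAlong renaming fst → pfst, snd → psnd, lift → plift

open ChosenPullbacksAlong (pullbackObj)

open FullSub (pext plift_fst plift_snd pcond)

variable {E : Type u} [Category.{v} E] [LCCC E] {I J : E}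

/-- A morphism of polynomials `F ⟶ G` presented by an arbitrary pullback `D` of `G.f` along `φ₀`. -/
structure Diagram (F G : Polyn I J) where
  D : E
  φ₀ : F.A ⟶ G.A
  φ₁ : D ⟶ G.B
  φ₂ : D ⟶ F.B
  isPullback : IsPullback φ₁ (φ₂ ≫ F.f) G.f φ₀
  src : φ₂ ≫ F.s = φ₁ ≫ G.s
  tgt : φ₀ ≫ G.t = F.t

/-- A morphism of polynomials `F ⟶ G`. The pullback `D` of `G.f` along `φ₀` that is part of a
morphism is the chosen one `Δ_{φ₀}`, and `φ₁` is its projection; this is what makes composition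
strictly associative and unital. By `Diagram.existsUnique_mor`, every diagram is isomorphic to
exactly one of this form. -/
structure Mor (F G : Polyn I J) where
  φ₀ : F.A ⟶ G.A
  φ₂ : pullbackObj G.f φ₀ ⟶ F.B
  w : φ₂ ≫ F.f = psnd G.f φ₀
  src : φ₂ ≫ F.s = pfst G.f φ₀ ≫ G.s
  tgt : φ₀ ≫ G.t = F.t

namespace Mor

variable {F G H K : Polyn I J}

abbrev D (φ : Mor F G) : E := pullbackObj G.f φ.φ₀

abbrev φ₁ (φ : Mor F G) : φ.D ⟶ G.B := pfst G.f φ.φ₀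

def toDiagram (φ : Mor F G) : Diagram F G where
  D := φ.D
  φ₀ := φ.φ₀
  φ₁ := φ.φ₁
  φ₂ := φ.φ₂
  isPullback := by rw [φ.w]; exact ChosenPullbacksAlong.isPullback _ _
  src := φ.src
  tgt := φ.tgt

theorem ext' {φ ψ : Mor F G} (h₀ : φ.φ₀ = ψ.φ₀)
    (h₂ : ∀ {X : E} (d : X ⟶ G.B) (a : X ⟶ F.A) (h : d ≫ G.f = a ≫ φ.φ₀),
      plift d a h ≫ φ.φ₂ = plift d a (by rw [h, h₀]) ≫ ψ.φ₂) : φ = ψ := by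
  obtain ⟨φ₀, φ₂, _, _, _⟩ := φ
  obtain ⟨ψ₀, ψ₂, _, _, _⟩ := ψ
  obtain rfl : φ₀ = ψ₀ := h₀
  have := h₂ (pfst G.f φ₀) (psnd G.f φ₀) (pcond _ _)
  rw [show plift (pfst G.f φ₀) (psnd G.f φ₀) (pcond _ _) = 𝟙 _ from
    pext (by simp) (by simp)] at this
  simp only [Category.id_comp] at this
  subst this
  rfl

/-- The identity morphism. -/
def id (F : Polyn I J) : Mor F F where
  φ₀ := 𝟙 _
  φ₂ := pfst F.f (𝟙 _)
  w := by rw [pcond, Category.comp_id]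
  src := rfl
  tgt := Category.id_comp _

/-- The comparison map `Δ_{ψ₀ φ₀} ⟶ Δ_{φ₀}` induced by `ψ₂`. -/
def compAux (φ : Mor F G) (ψ : Mor G H) : pullbackObj H.f (φ.φ₀ ≫ ψ.φ₀) ⟶ φ.D :=
  plift (plift (pfst H.f (φ.φ₀ ≫ ψ.φ₀)) (psnd H.f (φ.φ₀ ≫ ψ.φ₀) ≫ φ.φ₀)
      (by rw [pcond, Category.assoc]) ≫ ψ.φ₂)
    (psnd H.f (φ.φ₀ ≫ ψ.φ₀)) (by rw [Category.assoc, ψ.w, plift_snd])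

/-- Composition, in diagrammatic order. -/
def comp (φ : Mor F G) (ψ : Mor G H) : Mor F H where
  φ₀ := φ.φ₀ ≫ ψ.φ₀
  φ₂ := compAux φ ψ ≫ φ.φ₂
  w := by rw [Category.assoc, φ.w, compAux, plift_snd]
  src := by
    rw [Category.assoc, φ.src, compAux, ← Category.assoc, plift_fst, Category.assoc, ψ.src,
      ← Category.assoc, plift_fst]
  tgt := by rw [Category.assoc, ψ.tgt, φ.tgt]

theorem plift_comp_φ₂ (φ : Mor F G) (ψ : Mor G H) {X : E} (d : X ⟶ H.B) (a : X ⟶ F.A)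
    (h : d ≫ H.f = a ≫ φ.φ₀ ≫ ψ.φ₀) :
    plift d a h ≫ (comp φ ψ).φ₂ =
      plift (plift d (a ≫ φ.φ₀) (by rw [h, Category.assoc]) ≫ ψ.φ₂) a
        (by rw [Category.assoc, ψ.w, plift_snd]) ≫ φ.φ₂ := by
  refine (Category.assoc _ _ _).symm.trans (congrArg (· ≫ φ.φ₂) ?_)
  refine (FullSub.pre_plift _ _ _ _).trans (FullSub.plift_congr ?_ (plift_snd _ _ _) _)
  refine (Category.assoc _ _ _).symm.trans (congrArg (· ≫ ψ.φ₂) ?_)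
  refine (FullSub.pre_plift _ _ _ _).trans (FullSub.plift_congr (plift_fst _ _ _) ?_ _)
  rw [← Category.assoc, plift_snd]

end Mor

/-- Polynomials from `I` to `J` and their morphisms form a category. -/
instance category : Category (Polyn I J) where
  Hom F G := Mor F G
  id F := Mor.id F
  comp φ ψ := Mor.comp φ ψ
  id_comp {F G} φ := Mor.ext' (Category.id_comp _) fun d a h =>
    (Mor.plift_comp_φ₂ (Mor.id F) φ d a h).trans ((plift_fst _ _ _).trans
      (congrArg (· ≫ φ.φ₂) (FullSub.plift_congr rfl (Category.comp_id _) _)))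
  comp_id {F G} φ := Mor.ext' (Category.comp_id _) fun d a h =>
    (Mor.plift_comp_φ₂ φ (Mor.id G) d a h).trans
      (congrArg (· ≫ φ.φ₂) (FullSub.plift_congr (plift_fst _ _ _) rfl _))
  assoc {F G H K} φ ψ χ := Mor.ext' (Category.assoc _ _ _) fun d a h => by
    have h' : d ≫ K.f = a ≫ φ.φ₀ ≫ ψ.φ₀ ≫ χ.φ₀ := h.trans (by
      change a ≫ (φ.φ₀ ≫ ψ.φ₀) ≫ χ.φ₀ = _
      rw [Category.assoc])
    refine (Mor.plift_comp_φ₂ (Mor.comp φ ψ) χ d a h).trans ?_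
    refine Eq.trans ?_ (Mor.plift_comp_φ₂ φ (Mor.comp ψ χ) d a h').symm
    refine (Mor.plift_comp_φ₂ φ ψ _ a _).trans (congrArg (· ≫ φ.φ₂) ?_)
    refine FullSub.plift_congr ?_ rfl _
    refine Eq.trans ?_ (Mor.plift_comp_φ₂ ψ χ d (a ≫ φ.φ₀) _).symm
    refine congrArg (· ≫ ψ.φ₂) (FullSub.plift_congr ?_ rfl _)
    exact congrArg (· ≫ χ.φ₂) (FullSub.plift_congr rfl (Category.assoc _ _ _).symm _)

/-- Every diagram is isomorphic to exactly one morphism in the form used here. -/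
theorem Diagram.existsUnique_mor {F G : Polyn I J} (δ : Diagram F G) :
    ∃! φ : F ⟶ G, φ.φ₀ = δ.φ₀ ∧ ∃ e : φ.D ≅ δ.D,
      e.hom ≫ δ.φ₁ = φ.φ₁ ∧ e.hom ≫ δ.φ₂ = φ.φ₂ := by
  have hp := ChosenPullbacksAlong.isPullback G.f δ.φ₀
  refine ⟨Mor.mk δ.φ₀ ((hp.isoIsPullback _ _ δ.isPullback).hom ≫ δ.φ₂) ?_ ?_ δ.tgt,
    ⟨rfl, hp.isoIsPullback _ _ δ.isPullback, ?_, rfl⟩, ?_⟩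
  · rw [Category.assoc, IsPullback.isoIsPullback_hom_snd]
  · rw [Category.assoc, δ.src, ← Category.assoc, IsPullback.isoIsPullback_hom_fst]
  · exact IsPullback.isoIsPullback_hom_fst _ _ _ _
  · rintro ⟨ψ₀, ψ₂, h₁, h₂, h₃⟩ ⟨h₀, e, he₁, he₂⟩
    dsimp only at h₀
    subst h₀
    have : e.hom = (hp.isoIsPullback _ _ δ.isPullback).hom := by
      apply δ.isPullback.hom_ext
      · rw [IsPullback.isoIsPullback_hom_fst]; exact he₁
      · rw [IsPullback.isoIsPullback_hom_snd, ← Category.assoc, he₂]; exact h₁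
    have h : ψ₂ = (hp.isoIsPullback _ _ δ.isPullback).hom ≫ δ.φ₂ := by rw [← this]; exact he₂.symm
    subst h
    rfl

/-- An adjustment from `φ` to `ψ`: a morphism `D_φ ⟶ D_ψ` over `B`. -/
@[ext]
structure Adjustment {F G : Polyn I J} (φ ψ : F ⟶ G) where
  hom : Mor.D φ ⟶ Mor.D ψ
  w : hom ≫ ψ.φ₂ = φ.φ₂

/-- A morphism of polynomials is cartesian if `φ₂` is invertible. -/
abbrev IsCartesian {F G : Polyn I J} (φ : F ⟶ G) : Prop := IsIso (Mor.φ₂ φ)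

theorem isCartesian_id (F : Polyn I J) : IsCartesian (𝟙 F) := by
  refine ⟨plift (𝟙 F.B) F.f ((Category.id_comp F.f).trans (Category.comp_id F.f).symm), pext ?_ ?_, ?_⟩
  · exact (Category.assoc _ _ _).trans ((congrArg (_ ≫ ·) (plift_fst _ _ _)).trans (by
      rw [Category.comp_id, Category.id_comp]; rfl))
  · exact (Category.assoc _ _ _).trans ((congrArg (_ ≫ ·) (plift_snd _ _ _)).trans (by
      rw [Category.id_comp]; exact (Mor.id F).w))
  · exact plift_fst _ _ _

theorem isCartesian_comp {F G H : Polyn I J} (φ : F ⟶ G) (ψ : G ⟶ H) (hφ : IsCartesian φ)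
    (hψ : IsCartesian ψ) : IsCartesian (φ ≫ ψ) := by
  have hφ' : IsIso φ.φ₂ := hφ
  have : IsIso ψ.φ₂ := hψ
  have key : inv ψ.φ₂ ≫ psnd H.f ψ.φ₀ = G.f := by rw [← ψ.w, IsIso.inv_hom_id_assoc]
  have hc : IsIso (Mor.compAux φ ψ) := by
    refine ⟨plift (pfst G.f φ.φ₀ ≫ inv ψ.φ₂ ≫ pfst H.f ψ.φ₀) (psnd G.f φ.φ₀) ?_, ?_, ?_⟩
    · rw [Category.assoc, Category.assoc, pcond, reassoc_of% key, ← Category.assoc, pcond,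
        Category.assoc]
    · refine pext ?_ ?_
      · rw [Category.assoc, plift_fst, Mor.compAux, ← Category.assoc, plift_fst]
        simp
      · rw [Category.assoc, plift_snd, Mor.compAux, plift_snd, Category.id_comp]
    · refine pext ?_ ?_
      · rw [Category.assoc, Mor.compAux, plift_fst, ← Category.assoc, FullSub.pre_plift,
          Category.id_comp]
        rw [← cancel_mono (inv ψ.φ₂), Category.assoc, IsIso.hom_inv_id, Category.comp_id]
        refine pext ?_ ?_
        · rw [plift_fst, plift_fst, Category.assoc]
        · rw [plift_snd, ← Category.assoc, plift_snd, Category.assoc, key, pcond]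
      · rw [Category.assoc, Mor.compAux, plift_snd, plift_snd, Category.id_comp]
  exact @IsIso.comp_isIso _ _ _ _ _ (Mor.compAux φ ψ) φ.φ₂ hc hφ'

/-- If `ψ` is cartesian, there is exactly one adjustment from `φ` to `ψ`. -/
abbrev uniqueAdjustment {F G : Polyn I J} (φ ψ : F ⟶ G) (hψ : IsCartesian ψ) :
    Unique (Adjustment φ ψ) :=
  have : IsIso ψ.φ₂ := hψ
  { default := ⟨φ.φ₂ ≫ inv ψ.φ₂, by simp⟩
    uniq := fun α => Adjustment.ext (by
      rw [← cancel_mono ψ.φ₂, α.w]; simp) }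

end Polyn

open Polyn (Adjustment IsCartesian)

/-- The polynomials from `I` to `J`, as objects of the 2-category of polynomials, cartesian
morphisms of polynomials and adjustments. -/
@[ext]
structure PolyCart {E : Type u} [Category.{v} E] (I J : E) where
  poly : Polyn I J

namespace PolyCart

variable {E : Type u} [Category.{v} E] [LCCC E] {I J : E}

instance : CategoryStruct (PolyCart I J) where
  Hom F G := { φ : F.poly ⟶ G.poly // IsCartesian φ }
  id F := ⟨𝟙 F.poly, Polyn.isCartesian_id _⟩
  comp φ ψ := ⟨φ.1 ≫ ψ.1, Polyn.isCartesian_comp _ _ φ.2 ψ.2⟩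

/-- Adjustments, with identities and composition inherited from the slice over `B`. -/
instance homCat (F G : PolyCart I J) : Category (F ⟶ G) where
  Hom φ ψ := Adjustment φ.1 ψ.1
  id φ := ⟨𝟙 _, Category.id_comp _⟩
  comp α β := ⟨α.hom ≫ β.hom, by rw [Category.assoc, β.w, α.w]⟩
  id_comp _ := Adjustment.ext (Category.id_comp _)
  comp_id _ := Adjustment.ext (Category.comp_id _)
  assoc _ _ _ := Adjustment.ext (Category.assoc _ _ _)

/-- Between cartesian morphisms there is exactly one adjustment. -/
instance unique₂ {F G : PolyCart I J} (φ ψ : F ⟶ G) : Unique (φ ⟶ ψ) :=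
  Polyn.uniqueAdjustment φ.1 ψ.1 ψ.2

theorem id_comp' {F G : PolyCart I J} (φ : F ⟶ G) : 𝟙 F ≫ φ = φ :=
  Subtype.ext (Category.id_comp φ.1)
theorem comp_id' {F G : PolyCart I J} (φ : F ⟶ G) : φ ≫ 𝟙 G = φ :=
  Subtype.ext (Category.comp_id φ.1)
theorem assoc' {F G H K : PolyCart I J} (φ : F ⟶ G) (ψ : G ⟶ H) (χ : H ⟶ K) :
    (φ ≫ ψ) ≫ χ = φ ≫ ψ ≫ χ :=
  Subtype.ext (Category.assoc φ.1 ψ.1 χ.1)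

/-- The 2-category of polynomials from `I` to `J`, cartesian morphisms and adjustments. The
horizontal composite of two adjustments is the unique adjustment of the required type. -/
instance bicategory : Bicategory (PolyCart I J) where
  homCategory := homCat
  whiskerLeft _ _ _ _ := default
  whiskerRight _ _ := default
  associator φ ψ χ := eqToIso (assoc' φ ψ χ)
  leftUnitor φ := eqToIso (id_comp' φ)
  rightUnitor φ := eqToIso (comp_id' φ)
  whiskerLeft_id _ _ := Subsingleton.elim _ _
  whiskerLeft_comp _ _ _ _ _ _ := Subsingleton.elim _ _
  id_whiskerLeft _ := Subsingleton.elim _ _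
  comp_whiskerLeft _ _ _ _ _ := Subsingleton.elim _ _
  id_whiskerRight _ _ := Subsingleton.elim _ _
  comp_whiskerRight _ _ _ := Subsingleton.elim _ _
  whiskerRight_id _ := Subsingleton.elim _ _
  whiskerRight_comp _ _ _ := Subsingleton.elim _ _
  whisker_assoc _ _ _ _ _ := Subsingleton.elim _ _
  whisker_exchange _ _ := Subsingleton.elim _ _
  pentagon _ _ _ _ := Subsingleton.elim _ _
  triangle _ _ := Subsingleton.elim _ _

instance strict : Bicategory.Strict (PolyCart I J) where
  id_comp := id_comp'
  comp_id := comp_id'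
  assoc := assoc'
  leftUnitor_eqToIso _ := rfl
  rightUnitor_eqToIso _ := rfl
  associator_eqToIso _ _ _ := rfl

end PolyCart

/-! ## The internal category associated with a polynomial -/

namespace PolyCart

open ChosenPullbacksAlong renaming fst → pfst, snd → psnd, lift → plift

variable {E : Type u} [Category.{v} E] [LCCC E] {I J : E}

/-- The object `⟨s, t f⟩ : B ⟶ I × J` of the slice over `I × J`. -/
abbrev sliceB (F : PolyCart I J) : Over (I ⊗ J) := Over.mk (lift F.poly.s (F.poly.f ≫ F.poly.t))

/-- The object `id × t : I × A ⟶ I × J` of the slice over `I × J`. -/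
abbrev sliceA (F : PolyCart I J) : Over (I ⊗ J) := Over.mk (I ◁ F.poly.t)

/-- The morphism `⟨s, f⟩ : B ⟶ I × A` over `I × J`, a polynomial from `1` to `1` in the slice. -/
def sliceF (F : PolyCart I J) : sliceB F ⟶ sliceA F :=
  Over.homMk (lift F.poly.s F.poly.f) (by
    change lift F.poly.s F.poly.f ≫ I ◁ F.poly.t = lift F.poly.s (F.poly.f ≫ F.poly.t)
    simp)

/-- The top side `φ₁ φ₂⁻¹ : B ⟶ D` of the pullback square that represents a cartesian morphism. -/
def top {F G : PolyCart I J} (φ : F ⟶ G) : F.poly.B ⟶ G.poly.B :=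
  have : IsIso (Polyn.Mor.φ₂ φ.1) := φ.2
  inv (Polyn.Mor.φ₂ φ.1) ≫ Polyn.Mor.φ₁ φ.1

theorem top_isPullback {F G : PolyCart I J} (φ : F ⟶ G) :
    IsPullback (top φ) F.poly.f G.poly.f (Polyn.Mor.φ₀ φ.1) := by
  have : IsIso (Polyn.Mor.φ₂ φ.1) := φ.2
  refine IsPullback.of_iso (ChosenPullbacksAlong.isPullback G.poly.f (Polyn.Mor.φ₀ φ.1))
    (asIso (Polyn.Mor.φ₂ φ.1)) (Iso.refl _) (Iso.refl _) (Iso.refl _) ?_ ?_ ?_ ?_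
  · simp [top]
  · simpa using (Polyn.Mor.w φ.1).symm
  · simp
  · simp

theorem top_s {F G : PolyCart I J} (φ : F ⟶ G) : top φ ≫ G.poly.s = F.poly.s := by
  have : IsIso (Polyn.Mor.φ₂ φ.1) := φ.2
  rw [top, Category.assoc, IsIso.inv_comp_eq]
  exact (Polyn.Mor.src φ.1).symm

/-- The morphism `φ₁ φ₂⁻¹ : B ⟶ D` over `I × J`. -/
def sliceTop {F G : PolyCart I J} (φ : F ⟶ G) : sliceB F ⟶ sliceB G :=
  Over.homMk (top φ) (by
    change top φ ≫ lift G.poly.s (G.poly.f ≫ G.poly.t) = lift F.poly.s (F.poly.f ≫ F.poly.t)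
    rw [comp_lift, top_s, ← Category.assoc, (top_isPullback φ).w, Category.assoc,
      Polyn.Mor.tgt φ.1])

/-- The morphism `id × φ₀ : I × A ⟶ I × C` over `I × J`. -/
abbrev sliceBase {F G : PolyCart I J} (φ : F ⟶ G) : sliceA F ⟶ sliceA G :=
  Over.homMk (I ◁ Polyn.Mor.φ₀ φ.1) (by
    change I ◁ Polyn.Mor.φ₀ φ.1 ≫ I ◁ G.poly.t = I ◁ F.poly.t
    rw [← MonoidalCategory.whiskerLeft_comp, Polyn.Mor.tgt φ.1])

theorem prod_isPullback {F G : PolyCart I J} (φ : F ⟶ G) :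
    IsPullback (top φ) (lift F.poly.s F.poly.f) (lift G.poly.s G.poly.f)
      (I ◁ Polyn.Mor.φ₀ φ.1) := by
  have w : top φ ≫ lift G.poly.s G.poly.f = lift F.poly.s F.poly.f ≫ I ◁ Polyn.Mor.φ₀ φ.1 := by
    rw [comp_lift, top_s, (top_isPullback φ).w]
    simp
  have key {X : E} (d : X ⟶ G.poly.B) (a : X ⟶ I ⊗ F.poly.A)
      (h : d ≫ lift G.poly.s G.poly.f = a ≫ I ◁ Polyn.Mor.φ₀ φ.1) : ∃ b : X ⟶ F.poly.B,
        b ≫ top φ = d ∧ b ≫ lift F.poly.s F.poly.f = a := by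
    have h₁ : d ≫ G.poly.s = a ≫ fst I F.poly.A := by
      simpa using congrArg (· ≫ fst I G.poly.A) h
    have h₂ : d ≫ G.poly.f = (a ≫ snd I F.poly.A) ≫ Polyn.Mor.φ₀ φ.1 := by
      simpa using congrArg (· ≫ snd I G.poly.A) h
    have e₁ := (top_isPullback φ).lift_fst _ _ h₂
    refine ⟨(top_isPullback φ).lift _ _ h₂, e₁, ?_⟩
    ext
    · rw [Category.assoc, lift_fst, ← top_s φ, ← Category.assoc, e₁, h₁]
    · rw [Category.assoc, lift_snd, (top_isPullback φ).lift_snd]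
  choose L hL₁ hL₂ using @key
  refine ⟨⟨w⟩, ⟨Limits.PullbackCone.IsLimit.mk _
    (fun c => L c.fst c.snd c.condition) (fun c => hL₁ _ _ _) (fun c => hL₂ _ _ _) ?_⟩⟩
  intro c m h₁ h₂
  apply (top_isPullback φ).hom_ext
  · exact h₁.trans (hL₁ _ _ c.condition).symm
  · have := congrArg (· ≫ snd I F.poly.A) (h₂.trans (hL₂ _ _ c.condition).symm)
    simpa using this

/-- The pullback square over `I × J` that represents a cartesian morphism of polynomials, seen as a
morphism of polynomials from `1` to `1` in the slice over `I × J`. -/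
theorem slice_isPullback {F G : PolyCart I J} (φ : F ⟶ G) :
    IsPullback (sliceTop φ) (sliceF F) (sliceF G) (sliceBase φ) := by
  have sq := prod_isPullback φ
  have w : sliceTop φ ≫ sliceF G = sliceF F ≫ sliceBase φ := Over.OverMorphism.ext sq.w
  have key {X : Over (I ⊗ J)} (d : X ⟶ sliceB G) (a : X ⟶ sliceA F)
      (h : d ≫ sliceF G = a ≫ sliceBase φ) : ∃ b : X ⟶ sliceB F,
        b ≫ sliceTop φ = d ∧ b ≫ sliceF F = a := by
    have hl : d.left ≫ lift G.poly.s G.poly.f = a.left ≫ I ◁ Polyn.Mor.φ₀ φ.1 :=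
      congrArg CommaMorphism.left h
    have hX : sq.lift _ _ hl ≫ (sliceB F).hom = X.hom := by
      rw [← Over.w (sliceF F), ← Over.w a]
      exact (Category.assoc _ _ _).symm.trans
        (congrArg (· ≫ (sliceA F).hom) (sq.lift_snd _ _ hl))
    exact ⟨Over.homMk (sq.lift _ _ hl) hX, Over.OverMorphism.ext (sq.lift_fst _ _ hl),
      Over.OverMorphism.ext (sq.lift_snd _ _ hl)⟩
  choose L hL₁ hL₂ using @key
  refine ⟨⟨w⟩, ⟨Limits.PullbackCone.IsLimit.mk _
    (fun c => L c.fst c.snd c.condition) (fun c => hL₁ _ _ _) (fun c => hL₂ _ _ _) ?_⟩⟩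
  intro c m h₁ h₂
  apply Over.OverMorphism.ext
  apply sq.hom_ext
  · exact congrArg CommaMorphism.left (h₁.trans (hL₁ _ _ c.condition).symm)
  · exact congrArg CommaMorphism.left (h₂.trans (hL₂ _ _ c.condition).symm)

/-- The assignment `F ↦ 𝔸_F`, `φ ↦ 𝔸_φ`: a polynomial is sent to the internal full subcategory of
the slice over `I × J` associated with `⟨s, f⟩ : B ⟶ I × A`, a cartesian morphism to the internal
functor induced by the pullback square representing it. -/
def internalCat (I J : E) : Prefunctor (PolyCart I J) (InternalCat (Over (I ⊗ J))) where
  obj F := FullSub.full (sliceF F)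
  map φ := FullSub.mapFun (slice_isPullback φ)

end PolyCart

end

/-!
Two facts about the internal full subcategories `full f` of a locally cartesian closed category
carry the theorem.

The assignment of the internal functor `mapFun sq` to a pullback square `sq` respects identities
and pasting (`FullSub.mapFun_eq_id`, `FullSub.mapFun_eq_comp`), since an arrow of `full f` is
determined by its values on generalised elements (`FullSub.arr_ext`). As the square representing a
composite of cartesian morphisms of polynomials is the pasting of the two squares
(`PolyCart.top_comp`), `F ↦ 𝔸_F`, `φ ↦ 𝔸_φ` is strictly functorial.

Between the internal functors induced by two parallel pullback squares from `f : B ⟶ A` to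
`g : D ⟶ K`, with tops `p`, `p'` and bases `q`, `q'`, there is exactly one internal natural
transformation (`FullSub.uniqueNatTrans`). Its component at `a` is the map of fibres
`D_{q a} ≅ B_a ≅ D_{q' a}`. For uniqueness, let `α` be natural, let `d = p b` with `b` in `B_a`, and
let `k : B_a ⟶ B_a` be the constant map with value `b`. Naturality of `α` at `k`, evaluated at `d`,
says that `α d` is the value at `α d` of the constant map with value `p' b`, so `α d = p' b`.

Adjustments between cartesian morphisms are unique as well, so the functors on hom-categories are
full and faithful, and all the conditions on 2-cells hold trivially.
-/

namespace FullSub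

open ChosenPullbacksAlong renaming fst → pfst, snd → psnd, lift → plift

open ChosenPullbacksAlong (pullbackObj)

variable {C : Type u} [Category.{v} C] [LCCC C]

/-! ### Functoriality of the internal functor induced by a pullback square -/

theorem mapFun_eq_id {B A : C} {f : B ⟶ A} {p : B ⟶ B} {q : A ⟶ A} (sq : IsPullback p f f q)
    (hp : p = 𝟙 B) (hq : q = 𝟙 A) : mapFun sq = 𝟙 (full f) := by
  subst hp hq
  refine InternalCat.Fun.ext rfl ?_
  change mapArr sq = 𝟙 (Arr f)
  have hd : mapArr sq ≫ dom f = dom f := by rw [mapArr_dom, Category.comp_id]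
  refine arr_ext f ?_ ?_ ?_
  · rw [hd, Category.id_comp]
  · rw [mapArr_cod, Category.comp_id, Category.id_comp]
  · intro Y x b hb
    rw [ap_mapArr sq x b hb b (Category.comp_id _) (by rw [hb, Category.assoc, hd]),
      Category.comp_id]
    exact ap_congr f (Category.comp_id _).symm rfl _

theorem mapFun_eq_comp {B A D K M L : C} {f : B ⟶ A} {g : D ⟶ K} {h : M ⟶ L}
    {p : B ⟶ D} {q : A ⟶ K} {p' : D ⟶ M} {q' : K ⟶ L} {p'' : B ⟶ M} {q'' : A ⟶ L}
    (sq : IsPullback p f g q) (sq' : IsPullback p' g h q') (sq'' : IsPullback p'' f h q'')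
    (hp : p'' = p ≫ p') (hq : q'' = q ≫ q') : mapFun sq'' = mapFun sq ≫ mapFun sq' := by
  subst hp hq
  refine InternalCat.Fun.ext rfl ?_
  change mapArr sq'' = mapArr sq ≫ mapArr sq'
  refine arr_ext h ?_ ?_ ?_
  · rw [mapArr_dom, Category.assoc, mapArr_dom, ← Category.assoc, ← Category.assoc, mapArr_dom]
  · rw [mapArr_cod, Category.assoc, mapArr_cod, ← Category.assoc, ← Category.assoc, mapArr_cod]
  · intro Y x m hm
    have hm' : m ≫ h = (x ≫ dom f) ≫ q ≫ q' := by
      rw [hm, Category.assoc, mapArr_dom, Category.assoc]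
    have e₁ := sq''.lift_fst m _ hm'
    have e₂ := sq''.lift_snd m _ hm'
    have e₃ : (sq''.lift m _ hm' ≫ p) ≫ g = (x ≫ mapArr sq) ≫ dom g := by
      rw [Category.assoc, sq.w, ← Category.assoc, e₂, Category.assoc, Category.assoc, mapArr_dom]
    rw [ap_mapArr sq'' x m hm _ e₁ e₂, ap_congr h (Category.assoc x _ _).symm rfl,
      ap_mapArr sq' (x ≫ mapArr sq) m _ (sq''.lift m _ hm' ≫ p) (by rw [Category.assoc, e₁]) e₃,
      ap_mapArr sq x _ e₃ _ rfl e₂, Category.assoc]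

/-! ### Internal natural transformations between induced internal functors -/

section

variable {B A : C} (f : B ⟶ A)

/-- The endomorphism of the fibre of `f` over `f b` that is constant with value `b`, indexed by the
generalised element `b`. -/
noncomputable def const {X : C} (b : X ⟶ B) : X ⟶ Arr f :=
  curry f (b ≫ f) (b ≫ f) (psnd f (b ≫ f) ≫ b) (Category.assoc _ _ _)

theorem const_dom {X : C} (b : X ⟶ B) : const f b ≫ dom f = b ≫ f := curry_dom _ _ _ _ _
theorem const_cod {X : C} (b : X ⟶ B) : const f b ≫ cod f = b ≫ f := curry_cod _ _ _ _ _

theorem ap_const {X : C} (b c : X ⟶ B) (h : c ≫ f = const f b ≫ dom f) :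
    ap f (const f b) c h = b := by
  have hk : const f b = 𝟙 X ≫ const f b := (Category.id_comp _).symm
  rw [ap_congr f hk rfl]
  refine (ap_curry f _ _ _ (Category.assoc _ _ _) (𝟙 X) c (by rw [h]; congr 1)).trans ?_
  rw [← Category.assoc, plift_snd, Category.id_comp]

end

variable {B A D K : C} {f : B ⟶ A} {g : D ⟶ K} {p p' : B ⟶ D} {q q' : A ⟶ K}

/-- The family of maps `D_{q a} ≅ B_a ≅ D_{q' a}`, indexed by `a`. -/
noncomputable def compareFamily (sq : IsPullback p f g q) (p' : B ⟶ D) : pullbackObj g q ⟶ D :=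
  sq.lift (pfst g q) (psnd g q) (pcond g q) ≫ p'

theorem compareFamily_g (sq : IsPullback p f g q) (sq' : IsPullback p' f g q') :
    compareFamily sq p' ≫ g = psnd g q ≫ q' := by
  rw [compareFamily, Category.assoc, sq'.w, ← Category.assoc, sq.lift_snd]

/-- The components `D_{q a} ⟶ D_{q' a}` of the comparison of two pullback squares, as arrows of the
internal full subcategory associated with `g`. -/
noncomputable def compare (sq : IsPullback p f g q) (sq' : IsPullback p' f g q') : A ⟶ Arr g :=
  curry g q q' (compareFamily sq p') (compareFamily_g sq sq')

theorem compare_dom (sq : IsPullback p f g q) (sq' : IsPullback p' f g q') :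
    compare sq sq' ≫ dom g = q := curry_dom _ _ _ _ _
theorem compare_cod (sq : IsPullback p f g q) (sq' : IsPullback p' f g q') :
    compare sq sq' ≫ cod g = q' := curry_cod _ _ _ _ _

theorem ap_compare (sq : IsPullback p f g q) (sq' : IsPullback p' f g q') {X : C} (a : X ⟶ A)
    (d : X ⟶ D) (h : d ≫ g = (a ≫ compare sq sq') ≫ dom g) (b : X ⟶ B) (hb : b ≫ p = d)
    (hb' : b ≫ f = a) : ap g (a ≫ compare sq sq') d h = b ≫ p' := by
  refine (ap_curry g _ _ _ (compareFamily_g sq sq') a d h).trans ?_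
  refine (Category.assoc _ _ _).symm.trans (congrArg (· ≫ p') ?_)
  apply sq.hom_ext
  · rw [Category.assoc, sq.lift_fst, plift_fst, hb]
  · rw [Category.assoc, sq.lift_snd, plift_snd, hb']

/-- The internal natural transformation with components `D_{q a} ≅ B_a ≅ D_{q' a}`. -/
noncomputable def compareNatTrans (sq : IsPullback p f g q) (sq' : IsPullback p' f g q') :
    mapFun sq ⟶ mapFun sq' :=
  InternalCat.NatTrans.mk (A := full f) (B := full g) (F := mapFun sq) (G := mapFun sq')
    (compare sq sq') (compare_dom sq sq') (compare_cod sq sq') (by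
      have h₁ : mapArr sq ≫ cod g = (cod f ≫ compare sq sq') ≫ dom g := by
        rw [mapArr_cod, Category.assoc, compare_dom]
      have h₂ : (dom f ≫ compare sq sq') ≫ cod g = mapArr sq' ≫ dom g := by
        rw [mapArr_dom, Category.assoc, compare_cod]
      suffices plift (mapArr sq) (cod f ≫ compare sq sq') h₁ ≫ comp g =
        plift (dom f ≫ compare sq sq') (mapArr sq') h₂ ≫ comp g from this
      refine arr_ext g ?_ ?_ ?_
      · rw [lift_comp_dom, lift_comp_dom, mapArr_dom, Category.assoc, compare_dom]
      · rw [lift_comp_cod, lift_comp_cod, mapArr_cod, Category.assoc, compare_cod]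
      · intro Y x d hd
        have hd' : d ≫ g = (x ≫ dom f) ≫ q := by
          rw [hd, Category.assoc, lift_comp_dom, mapArr_dom, Category.assoc]
        have l₁ := sq.lift_fst d _ hd'
        have l₂ := sq.lift_snd d _ hd'
        have m₁ : x ≫ cod f ≫ compare sq sq' = (x ≫ cod f) ≫ compare sq sq' :=
          (Category.assoc _ _ _).symm
        have m₂ : x ≫ dom f ≫ compare sq sq' = (x ≫ dom f) ≫ compare sq sq' :=
          (Category.assoc _ _ _).symm
        have c₁ : d ≫ g = (x ≫ mapArr sq) ≫ dom g := by
          rw [hd', Category.assoc, Category.assoc, mapArr_dom]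
        have c₂ : d ≫ g = (x ≫ dom f ≫ compare sq sq') ≫ dom g := by
          rw [hd', Category.assoc, Category.assoc, Category.assoc, compare_dom]
        rw [ap_comp g _ _ _ _ (pre_comp g _ _ _ h₁) d _ c₁,
          ap_comp g _ _ _ _ (pre_comp g _ _ _ h₂) d _ c₂,
          ap_congr g rfl (ap_congr g m₂ rfl _),
          ap_congr g rfl (ap_compare sq sq' _ d _ _ l₁ l₂),
          ap_mapArr sq' x _ _ _ rfl l₂, ap_congr g m₁ (ap_mapArr sq x d _ _ l₁ l₂)]
        exact ap_compare sq sq' _ _ _ _ rfl (ap_f f _ _ _))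

/-- Naturality with respect to constant maps determines an internal natural transformation. -/
theorem natTrans_app_eq_compare (sq : IsPullback p f g q) (sq' : IsPullback p' f g q')
    (α : mapFun sq ⟶ mapFun sq') : InternalCat.NatTrans.app α = compare sq sq' := by
  let t : A ⟶ Arr g := InternalCat.NatTrans.app α
  have ht₀ : t ≫ dom g = q := InternalCat.NatTrans.app_dom α
  have ht₁ : t ≫ cod g = q' := InternalCat.NatTrans.app_cod α
  suffices t = compare sq sq' from this
  refine arr_ext g (ht₀.trans (compare_dom sq sq').symm) (ht₁.trans (compare_cod sq sq').symm) ?_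
  intro Y x d hd
  have hd' : d ≫ g = x ≫ q := by rw [hd, Category.assoc, ht₀]
  obtain ⟨b, hb, hb'⟩ : ∃ b : Y ⟶ B, b ≫ p = d ∧ b ≫ f = x :=
    ⟨sq.lift d x hd', sq.lift_fst _ _ _, sq.lift_snd _ _ _⟩
  rw [ap_compare sq sq' x d _ b hb hb']
  have kd : const f b ≫ dom f = x := (const_dom f b).trans hb'
  have kc : const f b ≫ cod f = x := (const_cod f b).trans hb'
  have h₁ : (const f b ≫ mapArr sq) ≫ cod g = (x ≫ t) ≫ dom g := by
    rw [Category.assoc, mapArr_cod, Category.assoc, ht₀, ← Category.assoc, kc]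
  have h₂ : (x ≫ t) ≫ cod g = (const f b ≫ mapArr sq') ≫ dom g := by
    rw [Category.assoc, ht₁, Category.assoc, mapArr_dom, ← Category.assoc, kd]
  have nat : plift (const f b ≫ mapArr sq) (x ≫ t) h₁ ≫ comp g =
      plift (x ≫ t) (const f b ≫ mapArr sq') h₂ ≫ comp g :=
    InternalCat.NatTrans.nat α (const f b) x x kd kc
  have hdm : d ≫ g = (plift (const f b ≫ mapArr sq) (x ≫ t) h₁ ≫ comp g) ≫ dom g := by
    rw [lift_comp_dom, hd', Category.assoc, mapArr_dom, ← Category.assoc, kd]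
  have hdk : d ≫ g = (const f b ≫ mapArr sq) ≫ dom g := hdm.trans (lift_comp_dom g _ _ h₁)
  -- The constant map with value `b` fixes `d = p b`, so the left side of naturality is `t d`.
  have left : ap g _ d hdm = ap g (x ≫ t) d hd := by
    rw [ap_comp g _ _ h₁ _ rfl d _ hdk]
    refine ap_congr g rfl ?_ _
    rw [ap_mapArr sq (const f b) d hdk b hb (hb'.trans kd.symm), ap_const, hb]
  -- The right side is a value of the constant map with value `p' b`.
  have right : ap g _ d hdm = b ≫ p' := by
    rw [ap_comp g _ _ h₂ _ nat d _ hd]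
    have hv : ap g (x ≫ t) d hd ≫ g = x ≫ q' := by rw [ap_f, Category.assoc, ht₁]
    rw [ap_mapArr sq' (const f b) _ _ (sq'.lift _ x hv) (sq'.lift_fst _ _ _)
      ((sq'.lift_snd _ _ _).trans kd.symm), ap_const]
  exact left.symm.trans right

/-- There is exactly one internal natural transformation between the internal functors induced by
two parallel pullback squares. -/
noncomputable abbrev uniqueNatTrans (sq : IsPullback p f g q) (sq' : IsPullback p' f g q') :
    Unique (mapFun sq ⟶ mapFun sq') where
  default := compareNatTrans sq sq'
  uniq α := InternalCat.hom₂_ext (natTrans_app_eq_compare sq sq' α)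

end FullSub

/-! ### Functoriality of the internal category associated with a polynomial -/

namespace PolyCart

variable {E : Type u} [Category.{v} E] [LCCC E] {I J : E}

theorem top_id (F : PolyCart I J) : top (𝟙 F) = 𝟙 F.poly.B := by
  have : IsIso (Polyn.Mor.φ₂ (𝟙 F : F ⟶ F).1) := (𝟙 F : F ⟶ F).2
  rw [top, IsIso.inv_comp_eq, Category.comp_id]
  rfl

theorem top_comp {F G H : PolyCart I J} (φ : F ⟶ G) (ψ : G ⟶ H) :
    top (φ ≫ ψ) = top φ ≫ top ψ := by
  have h₁ : IsIso (Polyn.Mor.φ₂ φ.1) := φ.2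
  have h₂ : IsIso (Polyn.Mor.φ₂ ψ.1) := ψ.2
  have h₃ : IsIso (Polyn.Mor.φ₂ (φ ≫ ψ).1) := (φ ≫ ψ).2
  rw [top, IsIso.inv_comp_eq, top, top]
  change _ = (Polyn.Mor.compAux φ.1 ψ.1 ≫ Polyn.Mor.φ₂ φ.1) ≫ _
  simp only [Category.assoc, IsIso.hom_inv_id_assoc]
  rw [Polyn.Mor.compAux, ← Category.assoc, FullSub.plift_fst, Category.assoc,
    IsIso.hom_inv_id_assoc, FullSub.plift_fst]
  rfl

theorem internalCat_map_id (F : PolyCart I J) :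
    (internalCat I J).map (𝟙 F) = 𝟙 ((internalCat I J).obj F) :=
  FullSub.mapFun_eq_id _ (Over.OverMorphism.ext (top_id F))
    (Over.OverMorphism.ext (MonoidalCategory.whiskerLeft_id I F.poly.A))

theorem internalCat_map_comp {F G H : PolyCart I J} (φ : F ⟶ G) (ψ : G ⟶ H) :
    (internalCat I J).map (φ ≫ ψ) = (internalCat I J).map φ ≫ (internalCat I J).map ψ :=
  FullSub.mapFun_eq_comp _ _ _ (Over.OverMorphism.ext (top_comp φ ψ))
    (Over.OverMorphism.ext (MonoidalCategory.whiskerLeft_comp I _ _))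

noncomputable instance uniqueMap₂ {F G : PolyCart I J} (φ ψ : F ⟶ G) :
    Unique ((internalCat I J).map φ ⟶ (internalCat I J).map ψ) :=
  FullSub.uniqueNatTrans (slice_isPullback φ) (slice_isPullback ψ)

/-- The 2-functor `F ↦ 𝔸_F`, `φ ↦ 𝔸_φ`, which sends an adjustment to the unique internal natural
transformation of the required type. -/
noncomputable def internalCatFunctor (I J : E) :
    StrictPseudofunctor (PolyCart I J) (InternalCat (Over (I ⊗ J))) :=
  StrictPseudofunctor.mk''
    { toPrefunctor := internalCat I J
      map₂ := fun _ => default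
      map₂_id := fun _ => Subsingleton.elim _ _
      map₂_comp := fun _ _ => Subsingleton.elim _ _
      map_id := internalCat_map_id
      map_comp := internalCat_map_comp
      map₂_whisker_left := fun _ _ _ _ => Subsingleton.elim _ _
      map₂_whisker_right := fun _ _ => Subsingleton.elim _ _ }

end PolyCart

theorem mainTheorem6 {E : Type u} [Category.{v} E] [LCCC E] (I J : E) :
    ∃ T : StrictPseudofunctor (PolyCart I J) (InternalCat (Over (I ⊗ J))),
      T.toFunctor.toPrefunctor = PolyCart.internalCat I J ∧
        ∀ F G : PolyCart I J, (T.mapFunctor F G).Full ∧ (T.mapFunctor F G).Faithful := by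
  refine ⟨PolyCart.internalCatFunctor I J, rfl, fun F G => ⟨⟨fun {φ ψ} α => ⟨default, ?_⟩⟩, ⟨?_⟩⟩⟩
  · exact (PolyCart.uniqueMap₂ φ ψ).instSubsingleton.elim _ _
  · intro φ ψ α β _
    exact Subsingleton.elim α β
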